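/- Theorem 5. Let $P$ and $P'$ be two 3-dimensional convex polytopes that are simple (each vertex lies in exactly three facets) and 3-colorable, i.e. the facets can be colored with the colors $1,2,3$ so that any two distinct facets sharing an edge receive different colors. For such a $P$, with vertex set $V(P)$, let $\xi_f\in\{0,1\}^{V(P)}$ be the incidence vector of a facet $f$ ($\xi_f(v)=1$ if and only if $v\in f$), and let $\widetilde P=\operatorname{conv}\{\xi_f : f \text{ a facet of } P\}\subseteq\mathbb R^{V(P)}$. Let $m(P)=(m_1(P),m_2(P),m_3(P))$ with $m_1(P)\le m_2(P)\le m_3(P)$ be the numbers of facets of the three colors in such a coloring, in increasing order (the result holds for any choice of colorings of $P$ and $P'$). Say that $m(P)=(m_1,m_2,m_3)$ has type I if $2\le m_1<m_2<m_3$, type II if $2\le m_1<m_2=m_3$, type III if $2\le m_1=m_2<m_3$, and type IV if $2\le m_1=m_2=m_3$. Then $\widetilde P$ and $\widetilde{P'}$ are combinatorially equivalent (have isomorphic face lattices) if and only if (1) $P$ and $P'$ have the same number of facets; (2) $m(P)$ and $m(P')$ have the same type; (3) $m_2(P)=m_2(P')$. Moreover, $P$ and $P'$ have the same number of facets if and only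 if they have the same number of vertices, and if and only if they have the same number of edges, so that condition (1) may equivalently be stated with vertices or edges. -/

import Mathlib

/-- Ambient space of the 3-dimensional polytopes. -/
abbrev Space3 : Type := EuclideanSpace ℝ (Fin 3)

/-- A convex polytope: the convex hull of a finite set of points. -/
def IsConvexPolytope {E : Type*} [AddCommGroup E] [Module ℝ E] (P : Set E) : Prop :=
  ∃ s : Set E, s.Finite ∧ P = convexHull ℝ s

/-- The dimension of a convex set (meaningful for nonempty sets): the dimension of its affine
span. -/
noncomputable def convexDim {E : Type*} [AddCommGroup E] [Module ℝ E] (P : Set E) : ℕ :=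
  Module.finrank ℝ (vectorSpan ℝ P)

/-- `F` is a nonempty face of dimension `k` of the polytope `P`; faces are the sets of maximisers
of linear functionals. -/
def IsFaceOfDim (P : Set Space3) (k : ℕ) (F : Set Space3) : Prop :=
  IsExposed ℝ P F ∧ F.Nonempty ∧ convexDim F = k

/-- The set `V(P)` of vertices of `P`. -/
abbrev polytopeVertices (P : Set Space3) : Set Space3 := Set.extremePoints ℝ P

/-- The set of edges (one-dimensional faces) of `P`. -/
def polytopeEdges (P : Set Space3) : Set (Set Space3) := {e | IsFaceOfDim P 1 e}

/-- The set of facets (two-dimensional faces) of a 3-polytope `P`. -/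
def polytopeFacets (P : Set Space3) : Set (Set Space3) := {f | IsFaceOfDim P 2 f}

/-- A simple 3-polytope: a 3-dimensional convex polytope each of whose vertices belongs to exactly
three facets. -/
structure IsSimpleThreePolytope (P : Set Space3) : Prop where
  polytope : IsConvexPolytope P
  dim_eq : convexDim P = 3
  simple : ∀ v ∈ polytopeVertices P, {f ∈ polytopeFacets P | v ∈ f}.ncard = 3

/-- A proper colouring of the facets by three colours: distinct facets that share an edge get
different colours. -/
def IsProperColoring (P : Set Space3) (c : polytopeFacets P → Fin 3) : Prop :=
  ∀ f g : polytopeFacets P, f ≠ g →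
    (∃ e ∈ polytopeEdges P, e ⊆ (f : Set Space3) ∧ e ⊆ (g : Set Space3)) → c f ≠ c g

/-- The number of facets of colour `i`. -/
noncomputable def colorCount {P : Set Space3} (c : polytopeFacets P → Fin 3) (i : Fin 3) : ℕ :=
  {f : polytopeFacets P | c f = i}.ncard

/-- The vector `m(P) = (m₁, m₂, m₃)` of the numbers of facets of each colour, sorted so that
`m₁ ≤ m₂ ≤ m₃`; the entries `m₁, m₂, m₃` have the indices `0, 1, 2`. -/
noncomputable def colorVector {P : Set Space3} (c : polytopeFacets P → Fin 3) : Fin 3 → ℕ :=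
  colorCount c ∘ Tuple.sort (colorCount c)

/-- The four types of sorted colour vectors. -/
inductive ColorType where
  | I
  | II
  | III
  | IV

/-- The sorted vector `m = (m₁, m₂, m₃)` has the given type. -/
def HasColorType (m : Fin 3 → ℕ) : ColorType → Prop
  | .I => 2 ≤ m 0 ∧ m 0 < m 1 ∧ m 1 < m 2
  | .II => 2 ≤ m 0 ∧ m 0 < m 1 ∧ m 1 = m 2
  | .III => 2 ≤ m 0 ∧ m 0 = m 1 ∧ m 1 < m 2
  | .IV => 2 ≤ m 0 ∧ m 0 = m 1 ∧ m 1 = m 2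

/-- Two sorted colour vectors are of the same type. -/
def SameColorType (m m' : Fin 3 → ℕ) : Prop :=
  ∃ t : ColorType, HasColorType m t ∧ HasColorType m' t

open Classical in
/-- The face-vertex incidence vector `ξ_f`, a function on the vertices of `P`. -/
noncomputable def incidenceVector (P f : Set Space3) : polytopeVertices P → ℝ :=
  fun v => if (v : Space3) ∈ f then 1 else 0

/-- The hull of `P`: the convex hull of the incidence vectors of its facets in `ℝ^{V(P)}`. -/
noncomputable def incidenceHull (P : Set Space3) : Set (polytopeVertices P → ℝ) :=
  convexHull ℝ (incidenceVector P '' polytopeFacets P)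

/-- The poset (by inclusion) of all faces of `Q`, including the empty face and `Q` itself. -/
abbrev FacePoset {E : Type*} [AddCommGroup E] [Module ℝ E] [TopologicalSpace E] (Q : Set E) :
    Type _ :=
  {F : Set E // IsExposed ℝ Q F}

/-- Combinatorial equivalence of polytopes: isomorphism of their face lattices. -/
def CombinatoriallyEquivalent {E E' : Type*} [AddCommGroup E] [Module ℝ E] [TopologicalSpace E]
    [AddCommGroup E'] [Module ℝ E'] [TopologicalSpace E'] (Q : Set E) (Q' : Set E') : Prop :=
  Nonempty (FacePoset Q ≃o FacePoset Q')

/-! Let n_0 ≤ n_1 ≤ n_2 be the sorted sizes of the colour classes. Every vertex lies in exactly one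
facet of each colour, so the incidence vectors of each class sum to the all-ones vector
(`sum_incidenceVector`). These sums generate all linear relations (`relation_eq_color`): moving
along an edge exchanges only one of the three facets at a vertex, so a relation has the same three
coefficients at every vertex. Hence prescribed values on the incidence vectors come from a linear
functional once their class sums agree (`exists_functional`).

A face of the hull is given by the facets at which a functional has zero deficit from its maximum.
The deficits in class k sum to α + β n_k, and such sums can be distributed freely within a class. So
a set S of facets spans a face iff some affine function t ↦ α + βt is nonnegative at all n_k and
vanishes at n_k exactly when S contains class k (`nonempty_facePoset_orderIso`).

The rest is combinatorics. As n_k ≥ 2, the empty set and all singletons are faces, so an isomorphism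
is a bijection of facets that preserves faces. The smallest non-faces have n_1 elements, and there
is only one of them exactly in type I. Conversely, in type I being a face depends only on class 1
and its complement (`isColorFace_iff_of_lt`); in the other types n_1, the total and the type
determine all sizes.

The equivalent forms of condition (1) follow from 3V = 2E and from 2F = V + 4, which is obtained by
sweeping with a generic functional. -/

/-! ### Generators of the dual of a finitely generated cone. -/

section Cone

variable {E : Type*} [AddCommGroup E] [Module ℝ E]

/-- Moving a functional that is nonnegative on `S` in the direction `m` until it acquires a new
zero on `S`. -/
theorem exists_pos_add_smul_nonneg_of_exists_neg {S : Finset E} {l m : Module.Dual ℝ E}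
    (hl : ∀ x ∈ S, 0 ≤ l x) (hm : ∀ x ∈ S, l x = 0 → m x = 0) (hneg : ∃ x ∈ S, m x < 0) :
    ∃ t : ℝ, 0 < t ∧ (∀ x ∈ S, 0 ≤ (l + t • m) x) ∧
      (S.filter fun x => (l + t • m) x ≠ 0).card < (S.filter fun x => l x ≠ 0).card := by
  classical
  -- Ratio test: `x₀` is a first point of `S` at which `l + t • m` reaches zero as `t` grows.
  obtain ⟨x₀, hx₀, hmin⟩ := Finset.exists_min_image (S.filter fun x => m x < 0)
    (fun x => l x / -m x) (by
      obtain ⟨x, hx, h⟩ := hneg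
      exact ⟨x, Finset.mem_filter.2 ⟨hx, h⟩⟩)
  rw [Finset.mem_filter] at hx₀
  have hlx₀ : 0 < l x₀ := lt_of_le_of_ne (hl _ hx₀.1) fun h => by
    have := hm _ hx₀.1 h.symm
    linarith [hx₀.2]
  have ht : 0 < l x₀ / -m x₀ := div_pos hlx₀ (by linarith [hx₀.2])
  have hzero : (l + (l x₀ / -m x₀) • m) x₀ = 0 := by
    have : m x₀ ≠ 0 := hx₀.2.ne
    simp only [LinearMap.add_apply, LinearMap.smul_apply, smul_eq_mul]
    field_simp
    ring
  refine ⟨l x₀ / -m x₀, ht, fun x hx => ?_, ?_⟩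
  · simp only [LinearMap.add_apply, LinearMap.smul_apply, smul_eq_mul]
    rcases lt_or_ge (m x) 0 with h | h
    · have h1 := hmin x (Finset.mem_filter.2 ⟨hx, h⟩)
      rw [le_div_iff₀ (by linarith)] at h1
      linarith
    · have := mul_nonneg ht.le h
      linarith [hl x hx]
  · apply Finset.card_lt_card
    rw [Finset.ssubset_iff_of_subset]
    · refine ⟨x₀, Finset.mem_filter.2 ⟨hx₀.1, hlx₀.ne'⟩, fun h => (Finset.mem_filter.1 h).2 hzero⟩
    · intro x hx
      rw [Finset.mem_filter] at hx ⊢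
      refine ⟨hx.1, fun h => hx.2 ?_⟩
      simp [h, hm x hx.1 h]

/-- The dual of the cone spanned by a finite spanning set `S` is generated by the functionals
whose zeros on `S` span a hyperplane. -/
theorem dual_cone_induction [FiniteDimensional ℝ E] {S : Finset E}
    (hS : Submodule.span ℝ (S : Set E) = ⊤) (p : Module.Dual ℝ E → Prop) (h0 : p 0)
    (hadd : ∀ l m, p l → p m → p (l + m)) (hsmul : ∀ (a : ℝ) l, 0 ≤ a → p l → p (a • l))
    (hfacet : ∀ l : Module.Dual ℝ E, (∀ x ∈ S, 0 ≤ l x) →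
      Module.finrank ℝ (Submodule.span ℝ {x | x ∈ S ∧ l x = 0}) + 1 = Module.finrank ℝ E → p l)
    (l : Module.Dual ℝ E) (hl : ∀ x ∈ S, 0 ≤ l x) : p l := by
  classical
  induction hn : (S.filter fun x => l x ≠ 0).card using Nat.strong_induction_on generalizing l with
  | _ n ih =>
    set W := Submodule.span ℝ {x | x ∈ S ∧ l x = 0} with hW
    by_cases h1 : Module.finrank ℝ W + 1 = Module.finrank ℝ E
    · exact hfacet l hl h1
    by_cases h2 : Module.finrank ℝ W = Module.finrank ℝ E
    · have hWtop : W = ⊤ := Submodule.eq_top_of_finrank_eq h2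
      have hker : W ≤ LinearMap.ker l := Submodule.span_le.2 fun x hx => hx.2
      have : l = 0 := by
        rw [hWtop, top_le_iff] at hker
        exact LinearMap.ker_eq_top.1 hker
      rwa [this]
    have hle : Module.finrank ℝ W ≤ Module.finrank ℝ E := Submodule.finrank_le W
    -- A functional that vanishes at the sum `e` but not on all of `S` takes both signs on `S`, so
    -- `l` can be moved both ways until it gains a zero.
    set e := ∑ x ∈ S, x
    have hlt : W ⊔ Submodule.span ℝ {e} < ⊤ := by
      refine lt_of_le_of_ne le_top fun htop => ?_
      have h3 := Submodule.finrank_add_le_finrank_add_finrank W (Submodule.span ℝ {e})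
      have h4 : Module.finrank ℝ (Submodule.span ℝ {e}) ≤ 1 := by
        simpa using finrank_span_le_card (R := ℝ) ({e} : Set E)
      rw [htop, finrank_top] at h3
      omega
    obtain ⟨m, hm0, hm⟩ := Submodule.exists_le_ker_of_lt_top _ hlt
    have hmW : ∀ x ∈ S, l x = 0 → m x = 0 := fun x hx hx0 =>
      hm (Submodule.mem_sup_left (Submodule.subset_span ⟨hx, hx0⟩))
    have hme : ∑ x ∈ S, m x = 0 := by
      rw [← map_sum]
      exact hm (Submodule.mem_sup_right (Submodule.mem_span_singleton_self e))
    have hmS : ∃ x ∈ S, m x ≠ 0 := by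
      by_contra! hcon
      apply hm0
      have : Submodule.span ℝ (S : Set E) ≤ LinearMap.ker m := Submodule.span_le.2 hcon
      rw [hS, top_le_iff] at this
      exact LinearMap.ker_eq_top.1 this
    have hneg : ∃ x ∈ S, m x < 0 := by
      obtain ⟨x, hx, hx0⟩ := hmS
      by_contra! hcon
      exact hx0 ((Finset.sum_eq_zero_iff_of_nonneg hcon).1 hme x hx)
    have hpos : ∃ x ∈ S, (-m) x < 0 := by
      obtain ⟨x, hx, hx0⟩ := hmS
      by_contra! hcon
      have := (Finset.sum_eq_zero_iff_of_nonneg hcon).1 (by simpa using hme) x hx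
      exact hx0 (by simpa using this)
    obtain ⟨t, ht, ht1, ht2⟩ := exists_pos_add_smul_nonneg_of_exists_neg hl hmW hneg
    obtain ⟨u, hu, hu1, hu2⟩ := exists_pos_add_smul_nonneg_of_exists_neg (m := -m) hl
      (fun x hx h => by simp [hmW x hx h]) hpos
    have hpt := ih _ (hn ▸ ht2) _ ht1 rfl
    have hpu := ih _ (hn ▸ hu2) _ hu1 rfl
    have key : l = (u / (t + u)) • (l + t • m) + (t / (t + u)) • (l + u • -m) := by
      have : t + u ≠ 0 := by positivity
      ext x
      simp only [LinearMap.add_apply, LinearMap.smul_apply, smul_eq_mul, LinearMap.neg_apply]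
      field_simp
      ring
    rw [key]
    exact hadd _ _ (hsmul _ _ (by positivity) hpt) (hsmul _ _ (by positivity) hpu)

end Cone

/-! ### Faces and vertices of polytopes. -/

section Faces

variable {E : Type*} [AddCommGroup E] [Module ℝ E] [TopologicalSpace E] [IsTopologicalAddGroup E]
  [ContinuousSMul ℝ E] [T2Space E] [LocallyConvexSpace ℝ E]

/-- By Krein–Milman a face is the closed hull of its extreme points; these are extreme in the whole
hull, hence lie in `s`. -/
theorem IsExposed.eq_convexHull_inter {s F : Set E} (hs : s.Finite)
    (hF : IsExposed ℝ (convexHull ℝ s) F) : F = convexHull ℝ (s ∩ F) := by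
  have hcomp : IsCompact (convexHull ℝ s) := hs.isCompact_convexHull ℝ
  have hconv : Convex ℝ F := hF.convex (convex_convexHull ℝ s)
  refine Set.Subset.antisymm ?_ (convexHull_min Set.inter_subset_right hconv)
  have hFc : IsCompact F := hF.isCompact hcomp
  have h1 := closure_convexHull_extremePoints hFc hconv
  have h2 : F.extremePoints ℝ ⊆ s ∩ F := fun x hx =>
    ⟨extremePoints_convexHull_subset (hF.isExtreme.extremePoints_subset_extremePoints hx), hx.1⟩
  have h3 : IsClosed (convexHull ℝ (s ∩ F)) :=
    ((hs.subset Set.inter_subset_left).isCompact_convexHull ℝ).isClosed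
  calc F = closure (convexHull ℝ (F.extremePoints ℝ)) := h1.symm
    _ ⊆ closure (convexHull ℝ (s ∩ F)) := closure_mono (convexHull_mono h2)
    _ = _ := h3.closure_eq

theorem convexHull_extremePoints_of_finite {s : Set E} (hs : s.Finite) :
    convexHull ℝ ((convexHull ℝ s).extremePoints ℝ) = convexHull ℝ s := by
  have hfin : ((convexHull ℝ s).extremePoints ℝ).Finite :=
    hs.subset extremePoints_convexHull_subset
  rw [← (hfin.isCompact_convexHull ℝ).isClosed.closure_eq,
    closure_convexHull_extremePoints (hs.isCompact_convexHull ℝ) (convex_convexHull ℝ s)]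

end Faces

/-- Over a finite set, some linear functional is injective. -/
theorem exists_dual_injOn {E : Type*} [AddCommGroup E] [Module ℝ E] {s : Set E} (hs : s.Finite) :
    ∃ l : Module.Dual ℝ E, Set.InjOn l s := by
  classical
  -- The functionals that identify two given points form a proper subspace, and finitely many proper
  -- subspaces do not cover the dual.
  set T : Finset (Subspace ℝ (Module.Dual ℝ E)) :=
    (hs.toFinset.offDiag).image fun q => LinearMap.ker (Module.Dual.eval ℝ E (q.1 - q.2)) with hT
  have htop : ⊤ ∉ T := by
    rw [hT, Finset.mem_image]
    rintro ⟨q, hq, h⟩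
    rw [LinearMap.ker_eq_top] at h
    have := (Module.forall_dual_apply_eq_zero_iff ℝ (q.1 - q.2)).1 fun l => by
      have := LinearMap.congr_fun h l
      simpa using this
    exact (Finset.mem_offDiag.1 hq).2.2 (sub_eq_zero.1 this)
  obtain ⟨l, hl⟩ := (Set.ne_univ_iff_exists_notMem _).1
    (Subspace.biUnion_ne_univ_of_top_notMem htop)
  refine ⟨l, fun x hx y hy hxy => ?_⟩
  by_contra hne
  apply hl
  simp only [Set.mem_iUnion]
  refine ⟨_, Finset.mem_image.2 ⟨(x, y), Finset.mem_offDiag.2 ⟨?_, ?_, hne⟩, rfl⟩, ?_⟩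
  · simpa using hx
  · simpa using hy
  · simp [hxy]

section Polytope

variable {P : Set Space3} {v : Space3}

theorem IsConvexPolytope.finite_vertices (hP : IsConvexPolytope P) :
    (polytopeVertices P).Finite := by
  obtain ⟨s, hs, rfl⟩ := hP
  exact hs.subset extremePoints_convexHull_subset

theorem IsConvexPolytope.convexHull_vertices (hP : IsConvexPolytope P) :
    convexHull ℝ (polytopeVertices P) = P := by
  obtain ⟨s, hs, rfl⟩ := hP
  exact convexHull_extremePoints_of_finite hs

theorem IsConvexPolytope.face_eq (hP : IsConvexPolytope P) {F : Set Space3}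
    (hF : IsExposed ℝ P F) : F = convexHull ℝ (polytopeVertices P ∩ F) := by
  have h := hP.convexHull_vertices
  rw [← h] at hF
  exact hF.eq_convexHull_inter hP.finite_vertices

theorem IsConvexPolytope.face_ext (hP : IsConvexPolytope P) {F G : Set Space3}
    (hF : IsExposed ℝ P F) (hG : IsExposed ℝ P G)
    (h : polytopeVertices P ∩ F = polytopeVertices P ∩ G) : F = G := by
  rw [hP.face_eq hF, h, ← hP.face_eq hG]

theorem IsConvexPolytope.finite_faces (hP : IsConvexPolytope P) (k : ℕ) :
    {F | IsFaceOfDim P k F}.Finite := by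
  refine Set.Finite.of_finite_image (f := fun F => polytopeVertices P ∩ F) ?_ ?_
  · refine hP.finite_vertices.finite_subsets.subset ?_
    rintro _ ⟨F, -, rfl⟩
    exact Set.inter_subset_left
  · exact fun F hF G hG h => hP.face_ext hF.1 hG.1 h

theorem IsConvexPolytope.exists_vertex_mem (hP : IsConvexPolytope P) {F : Set Space3}
    (hF : IsExposed ℝ P F) (hne : F.Nonempty) : ∃ v ∈ polytopeVertices P, v ∈ F := by
  rw [hP.face_eq hF, convexHull_nonempty_iff] at hne
  exact hne

/-- A functional which is nonnegative on the vertices is nonnegative on the polytope. -/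
theorem IsConvexPolytope.nonneg_of_vertices (hP : IsConvexPolytope P) (l : Module.Dual ℝ Space3)
    (h : ∀ x ∈ polytopeVertices P, 0 ≤ l (x - v)) : ∀ x ∈ P, 0 ≤ l (x - v) := by
  have hconv : Convex ℝ {x | l v ≤ l x} := convex_halfSpace_ge l.isLinear _
  intro x hx
  rw [← hP.convexHull_vertices] at hx
  have := convexHull_min (fun y hy => by simpa using h y hy) hconv hx
  simpa using this

theorem isExposed_zeros (l : Module.Dual ℝ Space3) (hv : v ∈ P) (hl : ∀ x ∈ P, 0 ≤ l (x - v)) :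
    IsExposed ℝ P {x | x ∈ P ∧ l (x - v) = 0} := by
  intro _
  refine ⟨-LinearMap.toContinuousLinearMap l, ?_⟩
  ext x
  simp only [Set.mem_ofPred_eq, map_sub, neg_apply,
    LinearMap.coe_toContinuousLinearMap', neg_le_neg_iff] at hl ⊢
  refine and_congr_right fun hx => ⟨fun h y hy => by linarith [hl y hy], fun h => ?_⟩
  linarith [hl x hx, h v hv]

theorem IsExposed.exists_zeros {F : Set Space3} (hF : IsExposed ℝ P F) (hv : v ∈ F) :
    ∃ l : Module.Dual ℝ Space3, (∀ x ∈ P, 0 ≤ l (x - v)) ∧ F = {x | x ∈ P ∧ l (x - v) = 0} := by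
  obtain ⟨l, rfl⟩ := hF ⟨v, hv⟩
  refine ⟨-l.toLinearMap, fun x hx => ?_, ?_⟩
  · simpa using hv.2 x hx
  · ext x
    simp only [Set.mem_ofPred_eq, LinearMap.neg_apply, ContinuousLinearMap.coe_coe, map_sub]
    refine and_congr_right fun hx => ⟨fun h => ?_, fun h y hy => ?_⟩
    · linarith [h v hv.1, hv.2 x hx]
    · linarith [hv.2 y hy]

theorem IsConvexPolytope.convexDim_face (hP : IsConvexPolytope P) {F : Set Space3}
    (hF : IsExposed ℝ P F) (hv : v ∈ polytopeVertices P) (hvF : v ∈ F) :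
    convexDim F = Module.finrank ℝ
      (Submodule.span ℝ ((fun x => x - v) '' (polytopeVertices P ∩ F))) := by
  have h1 : vectorSpan ℝ F = vectorSpan ℝ (polytopeVertices P ∩ F) := by
    conv_lhs => rw [hP.face_eq hF]
    rw [← direction_affineSpan, affineSpan_convexHull, direction_affineSpan]
  have h2 := vectorSpan_eq_span_vsub_set_right ℝ
    (s := polytopeVertices P ∩ F) (p := v) ⟨hv, hvF⟩
  rw [convexDim, h1, h2]
  rfl

/-- Some functional is minimal on `P` exactly at the vertex `v`. -/
theorem IsConvexPolytope.exists_strict (hP : IsConvexPolytope P) (hv : v ∈ polytopeVertices P) :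
    ∃ l : Module.Dual ℝ Space3, ∀ x ∈ polytopeVertices P, x ≠ v → 0 < l (x - v) := by
  have hnot : v ∉ convexHull ℝ (polytopeVertices P \ {v}) := by
    intro hmem
    have hsub : convexHull ℝ (polytopeVertices P \ {v}) ⊆ P :=
      (convexHull_mono Set.sdiff_subset).trans hP.convexHull_vertices.le
    have := inter_extremePoints_subset_extremePoints_of_subset (𝕜 := ℝ) hsub ⟨hmem, hv⟩
    exact (extremePoints_convexHull_subset this).2 rfl
  obtain ⟨f, u, hu, hf⟩ := geometric_hahn_banach_point_closed (convex_convexHull ℝ _)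
    ((hP.finite_vertices.subset Set.sdiff_subset).isCompact_convexHull ℝ).isClosed hnot
  refine ⟨f.toLinearMap, fun x hx hne => ?_⟩
  have := hf x (subset_convexHull ℝ _ ⟨hx, hne⟩)
  simp only [ContinuousLinearMap.coe_coe, map_sub]
  linarith

end Polytope

/-! ### Local coordinates at a vertex of a simple polytope. -/

theorem exists_smul_add_nonneg {E : Type*} [AddCommGroup E] [Module ℝ E] {S : Finset E}
    {l m : Module.Dual ℝ E} (hl : ∀ x ∈ S, 0 ≤ l x) (hm : ∀ x ∈ S, l x = 0 → m x = 0) :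
    ∃ R : ℝ, ∀ x ∈ S, 0 ≤ (R • l + m) x := by
  refine ⟨∑ x ∈ S, |m x| / l x, fun x hx => ?_⟩
  simp only [LinearMap.add_apply, LinearMap.smul_apply, smul_eq_mul]
  rcases (hl x hx).eq_or_lt with h | h
  · simp [← h, hm x hx h.symm]
  · have h1 : |m x| / l x ≤ ∑ x ∈ S, |m x| / l x :=
      Finset.single_le_sum (f := fun x => |m x| / l x)
        (fun y hy => div_nonneg (abs_nonneg _) (hl y hy)) hx
    rw [div_le_iff₀ h] at h1
    linarith [neg_abs_le (m x)]

/-- Coordinates at a vertex `v` of a simple 3-polytope: the inner normals `y i` of the three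
facets at `v`, and on each of the three edges at `v` a further vertex `w i`. -/
structure VertexChart (P : Set Space3) (v : Space3) where
  y : Fin 3 → Module.Dual ℝ Space3
  facet : Fin 3 → polytopeFacets P
  w : Fin 3 → Space3
  facet_injective : Function.Injective facet
  mem_iff : ∀ f : polytopeFacets P, v ∈ (f : Set Space3) ↔ ∃ i, facet i = f
  y_nonneg : ∀ i, ∀ x ∈ P, 0 ≤ y i (x - v)
  facet_eq : ∀ i, (facet i : Set Space3) = {x | x ∈ P ∧ y i (x - v) = 0}
  exists_coeff : ∀ l : Module.Dual ℝ Space3, ∃ c : Fin 3 → ℝ, ∀ x, l x = ∑ i, c i * y i x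
  w_mem : ∀ i, w i ∈ polytopeVertices P
  w_pos : ∀ i, 0 < y i (w i - v)
  w_zero : ∀ i j, j ≠ i → y j (w i - v) = 0

/-- The three facet normals at `v` generate the cone of functionals minimal at `v`. That cone spans
the dual space, so the normals form a basis, and a Farkas-type argument yields the edges. -/
theorem IsSimpleThreePolytope.nonempty_vertexChart {P : Set Space3} {v : Space3}
    (hP : IsSimpleThreePolytope P) (hv : v ∈ polytopeVertices P) : Nonempty (VertexChart P v) := by
  classical
  have hP' := hP.polytope
  have hvP : v ∈ P := hv.1
  have hE : Module.finrank ℝ Space3 = 3 := by simp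
  set S : Finset Space3 := hP'.finite_vertices.toFinset.image fun x => x - v with hSdef
  have hSmem : ∀ u, u ∈ S ↔ ∃ x ∈ polytopeVertices P, x - v = u := fun u => by
    simp [hSdef]
  have hScoe : (S : Set Space3) = (fun x => x - v) '' (polytopeVertices P ∩ P) := by
    rw [Set.inter_eq_left.2 (extremePoints_subset : polytopeVertices P ⊆ P)]
    ext u
    simp [hSmem]
  have hSspan : Submodule.span ℝ (S : Set Space3) = ⊤ := by
    apply Submodule.eq_top_of_finrank_eq
    rw [hScoe, ← hP'.convexDim_face (IsExposed.refl (𝕜 := ℝ) P) hv hvP, hP.dim_eq, hE]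
  have hSP : ∀ l : Module.Dual ℝ Space3, (∀ u ∈ S, 0 ≤ l u) → ∀ x ∈ P, 0 ≤ l (x - v) :=
    fun l hl => hP'.nonneg_of_vertices l fun x hx => hl _ ((hSmem _).2 ⟨x, hx, rfl⟩)
  have hSdim : ∀ l : Module.Dual ℝ Space3, (∀ u ∈ S, 0 ≤ l u) →
      convexDim {x | x ∈ P ∧ l (x - v) = 0} =
        Module.finrank ℝ (Submodule.span ℝ {u | u ∈ S ∧ l u = 0}) := by
    intro l hl
    rw [hP'.convexDim_face (isExposed_zeros l hvP (hSP l hl)) hv ⟨hvP, by simp⟩]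
    have hset : (fun x => x - v) '' (polytopeVertices P ∩ {x | x ∈ P ∧ l (x - v) = 0}) =
        {u | u ∈ S ∧ l u = 0} := by
      ext u
      constructor
      · rintro ⟨x, ⟨hx, -, hx0⟩, rfl⟩
        exact ⟨(hSmem _).2 ⟨x, hx, rfl⟩, hx0⟩
      · rintro ⟨hu, hx0⟩
        obtain ⟨x, hx, rfl⟩ := (hSmem u).1 hu
        exact ⟨x, ⟨hx, hx.1, hx0⟩, rfl⟩
    rw [hset]
  -- the three facets
  have hcard := hP.simple v hv
  have hfin : Finite {f // f ∈ {f ∈ polytopeFacets P | v ∈ f}} :=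
    Set.finite_of_ncard_pos (by omega)
  have e : Fin 3 ≃ {f // f ∈ {f ∈ polytopeFacets P | v ∈ f}} :=
    (Finite.equivFinOfCardEq hcard).symm
  set facet : Fin 3 → polytopeFacets P := fun i => ⟨(e i).1, (e i).2.1⟩ with hfacet
  have hinj : Function.Injective facet := fun i j h => by
    apply e.injective
    exact Subtype.ext (congrArg (fun f : polytopeFacets P => (f : Set Space3)) h)
  have hmem : ∀ f : polytopeFacets P, v ∈ (f : Set Space3) ↔ ∃ i, facet i = f := by
    intro f
    constructor
    · intro h
      refine ⟨e.symm ⟨f, f.2, h⟩, ?_⟩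
      simp [hfacet]
    · rintro ⟨i, rfl⟩
      exact (e i).2.2
  have hy : ∀ i, ∃ l : Module.Dual ℝ Space3, (∀ x ∈ P, 0 ≤ l (x - v)) ∧
      (facet i : Set Space3) = {x | x ∈ P ∧ l (x - v) = 0} := fun i =>
    (facet i).2.1.exists_zeros ((hmem _).2 ⟨i, rfl⟩)
  choose y y_nonneg facet_eq using hy
  have y_S : ∀ i, ∀ u ∈ S, 0 ≤ y i u := by
    intro i u hu
    obtain ⟨x, hx, rfl⟩ := (hSmem u).1 hu
    exact y_nonneg i x hx.1
  -- every functional in the dual cone is a nonnegative combination of the normals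
  have hdual : ∀ l : Module.Dual ℝ Space3, (∀ u ∈ S, 0 ≤ l u) →
      ∃ c : Fin 3 → ℝ, (∀ i, 0 ≤ c i) ∧ l = ∑ i, c i • y i := by
    refine dual_cone_induction hSspan
      (fun l => ∃ c : Fin 3 → ℝ, (∀ i, 0 ≤ c i) ∧ l = ∑ i, c i • y i) ?_ ?_ ?_ ?_
    · exact ⟨0, fun _ => le_rfl, by simp⟩
    · rintro _ _ ⟨c, hc, rfl⟩ ⟨d, hd, rfl⟩
      exact ⟨c + d, fun i => add_nonneg (hc i) (hd i), by
        simp [add_smul, Finset.sum_add_distrib]⟩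
    · rintro a _ ha ⟨c, hc, rfl⟩
      exact ⟨a • c, fun i => mul_nonneg ha (hc i), by simp [Finset.smul_sum, mul_smul]⟩
    · intro l hl hdim
      rw [hE] at hdim
      have hF : {x | x ∈ P ∧ l (x - v) = 0} ∈ polytopeFacets P :=
        ⟨isExposed_zeros l hvP (hSP l hl), ⟨v, hvP, by simp⟩, by rw [hSdim l hl]; omega⟩
      obtain ⟨i, hi⟩ := (hmem ⟨_, hF⟩).1 ⟨hvP, by simp⟩
      have hset : {x | x ∈ P ∧ l (x - v) = 0} = {x | x ∈ P ∧ y i (x - v) = 0} := by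
        rw [← facet_eq i, hi]
      -- `l` and `y i` both lie in the annihilator of the plane `W`, which is a line, so they are
      -- proportional.
      set W := Submodule.span ℝ {u | u ∈ S ∧ l u = 0} with hW
      have hann := Subspace.finrank_add_finrank_dualAnnihilator_eq W
      have hann1 : Module.finrank ℝ W.dualAnnihilator = 1 := by omega
      have hlW : l ∈ W.dualAnnihilator := by
        rw [Submodule.mem_dualAnnihilator]
        intro u hu
        exact (Submodule.span_le.2 (fun x hx => hx.2) : W ≤ LinearMap.ker l) hu
      have hyW : y i ∈ W.dualAnnihilator := by
        rw [Submodule.mem_dualAnnihilator]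
        intro u hu
        refine (Submodule.span_le.2 ?_ : W ≤ LinearMap.ker (y i)) hu
        rintro u ⟨hu, hu0⟩
        obtain ⟨x, hx, rfl⟩ := (hSmem u).1 hu
        have : x ∈ {x | x ∈ P ∧ l (x - v) = 0} := ⟨hx.1, hu0⟩
        rw [hset] at this
        exact this.2
      have hy0 : y i ≠ 0 := by
        intro h
        have h1 : (facet i : Set Space3) = P := by rw [facet_eq i, h]; simp
        have h2 := (facet i).2.2.2
        rw [h1, hP.dim_eq] at h2
        omega
      obtain ⟨c, hc⟩ := (finrank_eq_one_iff_of_nonzero' (⟨y i, hyW⟩ : W.dualAnnihilator)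
        (fun h => hy0 (congrArg Subtype.val h))).1 hann1 ⟨l, hlW⟩
      have hcl : c • y i = l := congrArg Subtype.val hc
      have hc0 : 0 ≤ c := by
        obtain ⟨u, hu, hu0⟩ : ∃ u ∈ S, y i u ≠ 0 := by
          by_contra! hcon
          apply hy0
          have : Submodule.span ℝ (S : Set Space3) ≤ LinearMap.ker (y i) :=
            Submodule.span_le.2 hcon
          rw [hSspan, top_le_iff] at this
          exact LinearMap.ker_eq_top.1 this
        have h1 : 0 ≤ c * y i u := by
          have := hl u hu
          rwa [← hcl] at this
        have h2 : 0 < y i u := lt_of_le_of_ne (y_S i u hu) hu0.symm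
        exact nonneg_of_mul_nonneg_left h1 h2
      refine ⟨Pi.single i c, fun j => ?_, ?_⟩
      · by_cases h : j = i
        · subst h; simpa using hc0
        · simp [h]
      · rw [Finset.sum_eq_single i (fun j _ hj => by simp [hj]) (by simp), Pi.single_eq_same, hcl]
  -- With `l` strictly minimal at `v` and `R` large, `m = (R • l + m) - R • l` is a difference of
  -- two elements of the dual cone.
  have hspan : ∀ l : Module.Dual ℝ Space3, ∃ c : Fin 3 → ℝ, l = ∑ i, c i • y i := by
    intro m
    obtain ⟨l, hl⟩ := hP'.exists_strict hv
    have hl0 : ∀ u ∈ S, 0 ≤ l u := by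
      intro u hu
      obtain ⟨x, hx, rfl⟩ := (hSmem u).1 hu
      by_cases h : x = v
      · simp [h]
      · exact (hl x hx h).le
    obtain ⟨R, hR⟩ := exists_smul_add_nonneg (m := m) hl0 (by
      intro u hu hu0
      obtain ⟨x, hx, rfl⟩ := (hSmem u).1 hu
      by_cases h : x = v
      · simp [h]
      · exact absurd hu0 (hl x hx h).ne')
    obtain ⟨c, -, hc⟩ := hdual _ hR
    obtain ⟨d, -, hd⟩ := hdual _ hl0
    refine ⟨c - R • d, ?_⟩
    have : m = ∑ i, c i • y i - R • l := by rw [← hc]; abel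
    rw [this, hd]
    ext x
    simp [sub_mul, Finset.sum_sub_distrib, Finset.mul_sum, mul_assoc]
  have hindep : LinearIndependent ℝ y := by
    apply linearIndependent_of_top_le_span_of_card_eq_finrank
    · intro l _
      obtain ⟨c, rfl⟩ := hspan l
      exact Submodule.sum_mem _ fun i _ =>
        Submodule.smul_mem _ _ (Submodule.subset_span ⟨i, rfl⟩)
    · rw [Subspace.dual_finrank_eq, hE, Fintype.card_fin]
  have hw : ∀ i, ∃ w ∈ polytopeVertices P, 0 < y i (w - v) ∧ ∀ j, j ≠ i → y j (w - v) = 0 := by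
    intro i
    by_contra! hcon
    -- If no such vertex exists, `y i` vanishes wherever `l` does, so `R • l - y i` is in the dual
    -- cone for some `R`; its coefficient -1 at `y i` contradicts independence.
    set l : Module.Dual ℝ Space3 := ∑ j ∈ Finset.univ.erase i, y j with hl
    have hlapp : ∀ u, l u = ∑ j ∈ Finset.univ.erase i, y j u := fun u => by simp [hl]
    have hl0 : ∀ u ∈ S, 0 ≤ l u := fun u hu => by
      rw [hlapp]
      exact Finset.sum_nonneg fun j _ => y_S j u hu
    obtain ⟨R, hR⟩ := exists_smul_add_nonneg (m := -y i) hl0 (by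
      intro u hu hu0
      rw [hlapp, Finset.sum_eq_zero_iff_of_nonneg fun j _ => y_S j u hu] at hu0
      obtain ⟨x, hx, rfl⟩ := (hSmem u).1 hu
      have h0 := y_S i _ hu
      rcases h0.eq_or_lt with h | h
      · simp only [LinearMap.neg_apply, ← h, neg_zero]
      · obtain ⟨j, hj, hne⟩ := hcon x hx h
        exact absurd (hu0 j (by simp [hj])) hne)
    obtain ⟨c, hc0, hc⟩ := hdual _ hR
    have hsum : ∑ j, (c j - if j = i then -1 else R) • y j = 0 := by
      ext x
      have h1 : R * l x - y i x = ∑ j, c j * y j x := by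
        simpa [sub_eq_add_neg] using LinearMap.congr_fun hc x
      have h2 : ∑ j, (if j = i then -1 else R) * y j x = R * l x - y i x := by
        rw [← Finset.add_sum_erase _ _ (Finset.mem_univ i), hlapp, Finset.mul_sum,
          Finset.sum_congr rfl (g := fun j => R * y j x) (fun j hj => by
            rw [if_neg (Finset.ne_of_mem_erase hj)])]
        simp only [if_true]
        ring
      simp only [LinearMap.sum_apply, LinearMap.smul_apply, smul_eq_mul, sub_mul,
        Finset.sum_sub_distrib, LinearMap.zero_apply]
      rw [h2, h1, sub_self]
    have := Fintype.linearIndependent_iff.1 hindep _ hsum i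
    simp only [if_true] at this
    linarith [hc0 i]
  choose w w_mem w_pos w_zero using hw
  refine ⟨⟨y, facet, w, hinj, hmem, y_nonneg, facet_eq, fun l => ?_, w_mem, w_pos, w_zero⟩⟩
  obtain ⟨c, rfl⟩ := hspan l
  exact ⟨c, fun x => by simp⟩

namespace VertexChart

variable {P : Set Space3} {v : Space3}

theorem mem_facet (C : VertexChart P v) (i : Fin 3) : v ∈ (C.facet i : Set Space3) :=
  (C.mem_iff _).2 ⟨i, rfl⟩

theorem w_mem_facet (C : VertexChart P v) {i j : Fin 3} (h : j ≠ i) :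
    C.w j ∈ (C.facet i : Set Space3) := by
  rw [C.facet_eq]
  exact ⟨(C.w_mem j).1, C.w_zero _ _ h.symm⟩

theorem w_notMem_facet (C : VertexChart P v) (i : Fin 3) :
    C.w i ∉ (C.facet i : Set Space3) := by
  rw [C.facet_eq]
  exact fun h => (C.w_pos i).ne' h.2

theorem eq_zero (C : VertexChart P v) {u : Space3} (h : ∀ i, C.y i u = 0) : u = 0 := by
  refine (Module.forall_dual_apply_eq_zero_iff ℝ u).1 fun l => ?_
  obtain ⟨c, hc⟩ := C.exists_coeff l
  simp [hc, h]

theorem apply_w_sub (C : VertexChart P v) {l : Module.Dual ℝ Space3} {c : Fin 3 → ℝ}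
    (hc : ∀ x, l x = ∑ i, c i * C.y i x) (i : Fin 3) :
    l (C.w i - v) = c i * C.y i (C.w i - v) := by
  rw [hc, Finset.sum_eq_single i (fun j _ hj => by rw [C.w_zero i j hj, mul_zero]) (by simp)]

/-- The edge at `v` opposite to the `i`-th facet. -/
def edge (C : VertexChart P v) (i : Fin 3) : Set Space3 :=
  {x | x ∈ P ∧ ∀ j, j ≠ i → C.y j (x - v) = 0}

theorem w_mem_edge (C : VertexChart P v) (i : Fin 3) : C.w i ∈ C.edge i :=
  ⟨(C.w_mem i).1, fun j hj => C.w_zero i j hj⟩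

theorem w_ne (C : VertexChart P v) (i : Fin 3) : C.w i ≠ v := fun h => by
  have := C.w_pos i
  simp [h] at this

theorem edge_subset_facet (C : VertexChart P v) {i j : Fin 3} (h : j ≠ i) :
    C.edge i ⊆ C.facet j := by
  rw [C.facet_eq]
  exact fun x hx => ⟨hx.1, hx.2 j h⟩

theorem edge_injective (C : VertexChart P v) : Function.Injective C.edge := by
  intro i j h
  by_contra hne
  have h1 := C.w_mem_edge i
  rw [h] at h1
  exact (C.w_pos i).ne' (h1.2 i hne)

theorem sub_eq_smul_of_mem_edge (C : VertexChart P v) {i : Fin 3} {x : Space3}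
    (hx : x ∈ C.edge i) :
    x - v = (C.y i (x - v) / C.y i (C.w i - v)) • (C.w i - v) := by
  rw [← sub_eq_zero]
  refine C.eq_zero fun j => ?_
  rw [map_sub, map_smul, smul_eq_mul]
  by_cases h : j = i
  · subst h
    rw [div_mul_cancel₀ _ (C.w_pos j).ne', sub_self]
  · rw [hx.2 j h, C.w_zero i j h, mul_zero, sub_zero]

theorem edge_mem_polytopeEdges (C : VertexChart P v) (hP : IsConvexPolytope P)
    (hv : v ∈ polytopeVertices P) (i : Fin 3) : C.edge i ∈ polytopeEdges P := by
  have hvP : v ∈ P := hv.1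
  have hexp : IsExposed ℝ P (C.edge i) := by
    have h := isExposed_zeros (∑ j ∈ Finset.univ.erase i, C.y j) hvP (fun x hx => by
      rw [LinearMap.sum_apply]
      exact Finset.sum_nonneg fun j _ => C.y_nonneg j x hx)
    convert h using 1
    ext x
    refine and_congr_right fun hx => ?_
    rw [LinearMap.sum_apply, Finset.sum_eq_zero_iff_of_nonneg fun j _ => C.y_nonneg j x hx]
    simp
  have hve : v ∈ C.edge i := ⟨hvP, by simp⟩
  refine ⟨hexp, ⟨v, hve⟩, ?_⟩
  rw [hP.convexDim_face hexp hv hve]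
  have : Submodule.span ℝ ((fun x => x - v) '' (polytopeVertices P ∩ C.edge i)) =
      Submodule.span ℝ {C.w i - v} := by
    apply le_antisymm
    · rw [Submodule.span_le]
      rintro _ ⟨x, ⟨-, hx⟩, rfl⟩
      exact Submodule.mem_span_singleton.2 ⟨_, (C.sub_eq_smul_of_mem_edge hx).symm⟩
    · rw [Submodule.span_le, Set.singleton_subset_iff]
      exact Submodule.subset_span ⟨C.w i, ⟨C.w_mem i, C.w_mem_edge i⟩, rfl⟩
  rw [this, finrank_span_singleton (sub_ne_zero.2 (C.w_ne i))]

/-- A functional exposing `e` has coefficients `c i ≥ 0` in the normals, and `e` contains `w i`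
whenever `c i = 0`. Dimension one forces exactly one zero coefficient. -/
theorem exists_edge_eq (C : VertexChart P v) (hP : IsConvexPolytope P)
    (hv : v ∈ polytopeVertices P) {e : Set Space3} (he : e ∈ polytopeEdges P) (hve : v ∈ e) :
    ∃ i, C.edge i = e := by
  obtain ⟨hexp, -, hdim⟩ := he
  rw [hP.convexDim_face hexp hv hve] at hdim
  obtain ⟨l, hl, hle⟩ := hexp.exists_zeros hve
  obtain ⟨c, hc⟩ := C.exists_coeff l
  have hc0 : ∀ i, 0 ≤ c i := fun i => by
    have := hl _ (C.w_mem i).1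
    rw [C.apply_w_sub hc] at this
    exact nonneg_of_mul_nonneg_left this (C.w_pos i)
  have hmem : ∀ x, x ∈ e ↔ x ∈ P ∧ ∀ j, c j = 0 ∨ C.y j (x - v) = 0 := by
    intro x
    rw [hle]
    refine and_congr_right fun hx => ?_
    rw [hc, Finset.sum_eq_zero_iff_of_nonneg fun j _ => mul_nonneg (hc0 j) (C.y_nonneg j x hx)]
    simp
  have hwe : ∀ i, c i = 0 → C.w i ∈ e := fun i hi => (hmem _).2 ⟨(C.w_mem i).1, fun j => by
    by_cases h : j = i
    · exact Or.inl (h ▸ hi)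
    · exact Or.inr (C.w_zero i j h)⟩
  have hsub : ∀ i, c i = 0 → C.w i - v ∈
      Submodule.span ℝ ((fun x => x - v) '' (polytopeVertices P ∩ e)) := fun i hi =>
    Submodule.subset_span ⟨C.w i, ⟨C.w_mem i, hwe i hi⟩, rfl⟩
  obtain ⟨i, hi⟩ : ∃ i, c i = 0 := by
    by_contra! hcon
    have : Submodule.span ℝ ((fun x => x - v) '' (polytopeVertices P ∩ e)) = ⊥ := by
      rw [Submodule.span_eq_bot]
      rintro _ ⟨x, ⟨-, hx⟩, rfl⟩
      exact C.eq_zero fun j => (((hmem x).1 hx).2 j).resolve_left (hcon j)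
    rw [this, finrank_bot] at hdim
    omega
  have hne : ∀ j, j ≠ i → c j ≠ 0 := by
    intro j hji hj
    obtain ⟨t, ht⟩ := (finrank_eq_one_iff_of_nonzero' (⟨C.w i - v, hsub i hi⟩ : Submodule.span ℝ
      ((fun x => x - v) '' (polytopeVertices P ∩ e)))
      (fun h => C.w_ne i (sub_eq_zero.1 (congrArg Subtype.val h)))).1 hdim ⟨_, hsub j hj⟩
    have ht' : t • (C.w i - v) = C.w j - v := congrArg Subtype.val ht
    have := C.w_pos j
    rw [← ht', map_smul, C.w_zero i j hji, smul_zero] at this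
    exact this.false
  refine ⟨i, Set.ext fun x => ?_⟩
  rw [hmem]
  refine and_congr_right fun _ => ⟨fun h j => ?_, fun h j hj => (h j).resolve_left (hne j hj)⟩
  by_cases hj : j = i
  · exact Or.inl (hj ▸ hi)
  · exact Or.inr (h j hj)

/-- On the ray from `v` through `w i`, of any three distinct points the middle one is not extreme.
-/
theorem vertices_inter_edge (C : VertexChart P v) (hv : v ∈ polytopeVertices P) (i : Fin 3) :
    polytopeVertices P ∩ C.edge i = {v, C.w i} := by
  apply Set.Subset.antisymm
  · rintro x ⟨hx, hxe⟩
    have hsmul := C.sub_eq_smul_of_mem_edge hxe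
    have ht0 : 0 ≤ C.y i (x - v) / C.y i (C.w i - v) :=
      div_nonneg (C.y_nonneg i x hx.1) (C.w_pos i).le
    set t := C.y i (x - v) / C.y i (C.w i - v)
    have hxt : x = v + t • (C.w i - v) := by rw [← hsmul]; abel
    rcases ht0.eq_or_lt with h0 | h0
    · left
      rw [hxt, ← h0, zero_smul, add_zero]
    rcases lt_trichotomy t 1 with h1 | h1 | h1
    · left
      refine (hx.2 hv.1 (C.w_mem i).1 ⟨1 - t, t, by linarith, h0, by ring, ?_⟩).symm
      rw [hxt]
      module
    · right
      rw [hxt, h1, one_smul]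
      simp
    · left
      have hw : C.w i ∈ openSegment ℝ x v := by
        refine ⟨1 / t, 1 - 1 / t, by positivity, ?_, by ring, ?_⟩
        · rw [sub_pos, div_lt_one h0]
          exact h1
        · have hinv : C.w i - v = (1 / t) • (x - v) := by
            rw [hsmul, smul_smul, one_div_mul_cancel h0.ne', one_smul]
          rw [← sub_add_cancel (C.w i) v, hinv]
          module
      have h2 := (C.w_mem i).2 hx.1 hv.1 hw
      have h3 := (C.w_mem i).2 hv.1 hx.1 (by rwa [openSegment_symm])
      rw [h2, ← h3]
  · rintro x (rfl | rfl)
    · exact ⟨hv, hv.1, by simp⟩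
    · exact ⟨C.w_mem i, C.w_mem_edge i⟩

theorem coeff_pos_iff (C : VertexChart P v) {l : Module.Dual ℝ Space3} {c : Fin 3 → ℝ}
    (hc : ∀ x, l x = ∑ i, c i * C.y i x) (i : Fin 3) : 0 < c i ↔ l v < l (C.w i) := by
  rw [← sub_pos (a := l (C.w i)), ← map_sub, C.apply_w_sub hc, mul_pos_iff_of_pos_right (C.w_pos i)]

theorem coeff_neg_iff (C : VertexChart P v) {l : Module.Dual ℝ Space3} {c : Fin 3 → ℝ}
    (hc : ∀ x, l x = ∑ i, c i * C.y i x) (i : Fin 3) : c i < 0 ↔ l (C.w i) < l v := by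
  rw [← sub_neg (a := l (C.w i)), ← map_sub, C.apply_w_sub hc]
  refine ⟨fun h => mul_neg_of_neg_of_pos h (C.w_pos i), fun h => ?_⟩
  by_contra h'
  exact absurd (mul_nonneg (not_lt.1 h') (C.w_pos i).le) (not_le.2 h)

theorem le_of_coeff_nonneg (C : VertexChart P v) {l : Module.Dual ℝ Space3} {c : Fin 3 → ℝ}
    (hc : ∀ x, l x = ∑ i, c i * C.y i x) {x : Space3} (hx : x ∈ P)
    (h : ∀ i, C.y i (x - v) = 0 ∨ 0 ≤ c i) : l v ≤ l x := by
  rw [← sub_nonneg, ← map_sub, hc]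
  refine Finset.sum_nonneg fun i _ => ?_
  rcases h i with h | h
  · simp [h]
  · exact mul_nonneg h (C.y_nonneg i x hx)

/-- The principle of the simplex method: a vertex with no ascending edge is a global maximum. -/
theorem exists_lt_of_lt (C : VertexChart P v) {l : Module.Dual ℝ Space3} {x : Space3}
    (hx : x ∈ P) (h : l v < l x) : ∃ i, l v < l (C.w i) := by
  by_contra! hcon
  obtain ⟨c, hc⟩ := C.exists_coeff (-l)
  have := C.le_of_coeff_nonneg hc hx fun i => Or.inr <| by
    have := mt (C.coeff_neg_iff hc i).1
    simp only [not_lt, LinearMap.neg_apply, neg_le_neg_iff] at this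
    exact this (hcon i)
  simp only [LinearMap.neg_apply, neg_le_neg_iff] at this
  linarith

end VertexChart

/-! ### Vertices and edges. -/

namespace IsSimpleThreePolytope

variable {P : Set Space3}

/-- Double count of incidences: three edges at each vertex, two vertices on each edge. -/
theorem vertices_mul_three (hP : IsSimpleThreePolytope P) :
    (polytopeVertices P).ncard * 3 = (polytopeEdges P).ncard * 2 := by
  classical
  have hV := hP.polytope.finite_vertices
  have hE : (polytopeEdges P).Finite := hP.polytope.finite_faces 1
  rw [Set.ncard_eq_toFinset_card _ hV, Set.ncard_eq_toFinset_card _ hE]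
  apply Finset.card_mul_eq_card_mul (fun v e => v ∈ e)
  · intro v hv
    rw [Set.Finite.mem_toFinset] at hv
    obtain ⟨C⟩ := hP.nonempty_vertexChart hv
    have : hE.toFinset.bipartiteAbove (fun v e => v ∈ e) v = Finset.univ.image C.edge := by
      ext e
      simp only [Finset.mem_bipartiteAbove, Set.Finite.mem_toFinset, Finset.mem_image,
        Finset.mem_univ, true_and]
      constructor
      · rintro ⟨he, hve⟩
        exact C.exists_edge_eq hP.polytope hv he hve
      · rintro ⟨i, rfl⟩
        exact ⟨C.edge_mem_polytopeEdges hP.polytope hv i, hv.1, by simp⟩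
    rw [this, Finset.card_image_of_injective _ C.edge_injective, Finset.card_univ,
      Fintype.card_fin]
  · intro e he
    rw [Set.Finite.mem_toFinset] at he
    obtain ⟨v, hv, hve⟩ := hP.polytope.exists_vertex_mem he.1 he.2.1
    obtain ⟨C⟩ := hP.nonempty_vertexChart hv
    obtain ⟨i, rfl⟩ := C.exists_edge_eq hP.polytope hv he hve
    have : hV.toFinset.bipartiteBelow (fun v e => v ∈ e) (C.edge i) = {v, C.w i} := by
      ext x
      have := Set.ext_iff.1 (C.vertices_inter_edge hv i) x
      simpa using this
    rw [this, Finset.card_pair (C.w_ne i).symm]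

theorem nonempty (hP : IsSimpleThreePolytope P) : P.Nonempty := by
  by_contra h
  rw [Set.not_nonempty_iff_eq_empty] at h
  have := hP.dim_eq
  rw [convexDim, h, vectorSpan_empty, finrank_bot] at this
  omega

theorem vertices_nonempty (hP : IsSimpleThreePolytope P) : (polytopeVertices P).Nonempty := by
  obtain ⟨v, hv, -⟩ := hP.polytope.exists_vertex_mem (IsExposed.refl (𝕜 := ℝ) P) hP.nonempty
  exact ⟨v, hv⟩

end IsSimpleThreePolytope

/-! ### Euler's relation. -/

/-- Read `b j` as "edge j ascends". Facet i contains the two edges j ≠ i, so the left side counts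
the facets at a vertex of which it is the lowest or the highest point: three at a source or sink,
otherwise one. -/
theorem card_filter_sign (b : Fin 3 → Bool) :
    (Finset.univ.filter fun i => ∀ j, j ≠ i → b j = true).card +
      (Finset.univ.filter fun i => ∀ j, j ≠ i → b j = false).card =
    1 + ((if ∀ j, b j = true then 2 else 0) + if ∀ j, b j = false then 2 else 0) := by
  revert b
  decide

/-- `v` minimises `l` among the vertices of `P` in `F`. -/
def IsMinVertex (P : Set Space3) (l : Module.Dual ℝ Space3) (F : Set Space3) (v : Space3) : Prop :=
  v ∈ F ∧ ∀ x ∈ polytopeVertices P, x ∈ F → l v ≤ l x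

theorem VertexChart.isMinVertex_facet_iff {P : Set Space3} {v : Space3} (C : VertexChart P v)
    {l : Module.Dual ℝ Space3} (hv : v ∈ polytopeVertices P)
    (hl : Set.InjOn l (polytopeVertices P)) (i : Fin 3) :
    IsMinVertex P l (C.facet i) v ↔ ∀ j, j ≠ i → l v < l (C.w j) := by
  obtain ⟨c, hc⟩ := C.exists_coeff l
  constructor
  · intro h j hj
    refine lt_of_le_of_ne (h.2 _ (C.w_mem j) (C.w_mem_facet hj)) fun heq => ?_
    exact C.w_ne j (hl (C.w_mem j) hv heq.symm)
  · intro h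
    refine ⟨C.mem_facet i, fun x hx hxf => C.le_of_coeff_nonneg hc hx.1 fun j => ?_⟩
    by_cases hj : j = i
    · rw [C.facet_eq] at hxf
      exact Or.inl (hj ▸ hxf.2)
    · exact Or.inr ((C.coeff_pos_iff hc j).2 (h j hj)).le

theorem VertexChart.isMinVertex_self_iff {P : Set Space3} {v : Space3} (C : VertexChart P v)
    {l : Module.Dual ℝ Space3} (hv : v ∈ polytopeVertices P)
    (hl : Set.InjOn l (polytopeVertices P)) :
    IsMinVertex P l P v ↔ ∀ j, l v < l (C.w j) := by
  obtain ⟨c, hc⟩ := C.exists_coeff l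
  constructor
  · intro h j
    refine lt_of_le_of_ne (h.2 _ (C.w_mem j) (C.w_mem j).1) fun heq => ?_
    exact C.w_ne j (hl (C.w_mem j) hv heq.symm)
  · intro h
    exact ⟨hv.1, fun x hx _ => C.le_of_coeff_nonneg hc hx.1 fun j =>
      Or.inr ((C.coeff_pos_iff hc j).2 (h j)).le⟩

open Classical in
theorem IsConvexPolytope.card_filter_isMinVertex {P : Set Space3} (hP : IsConvexPolytope P)
    {l : Module.Dual ℝ Space3} (hl : Set.InjOn l (polytopeVertices P)) {F : Set Space3}
    (hF : IsExposed ℝ P F) (hne : F.Nonempty) :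
    (hP.finite_vertices.toFinset.filter (IsMinVertex P l F)).card = 1 := by
  obtain ⟨v, hv, hvF⟩ := hP.exists_vertex_mem hF hne
  obtain ⟨x, hx, hmin⟩ := Finset.exists_min_image
    (hP.finite_vertices.toFinset.filter (· ∈ F)) l ⟨v, by simp [hv, hvF]⟩
  simp only [Finset.mem_filter, Set.Finite.mem_toFinset, and_imp] at hx hmin
  rw [Finset.card_eq_one]
  refine ⟨x, Finset.eq_singleton_iff_unique_mem.2 ⟨?_, ?_⟩⟩
  · simp only [Finset.mem_filter, Set.Finite.mem_toFinset]
    exact ⟨hx.1, hx.2, hmin⟩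
  · intro z hz
    simp only [Finset.mem_filter, Set.Finite.mem_toFinset] at hz
    exact hl hz.1 hx.1 (le_antisymm (hz.2.2 x hx.1 hx.2) (hmin z hz.1 hz.2.1))

open Classical in
theorem VertexChart.card_filter_isMinVertex {P : Set Space3} {v : Space3}
    [Fintype (polytopeFacets P)] (C : VertexChart P v)
    {l : Module.Dual ℝ Space3} (hv : v ∈ polytopeVertices P)
    (hl : Set.InjOn l (polytopeVertices P)) :
    (Finset.univ.filter fun f : polytopeFacets P => IsMinVertex P l f v).card =
      (Finset.univ.filter fun i => ∀ j, j ≠ i → l v < l (C.w j)).card := by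
  rw [← Finset.card_image_of_injective _ C.facet_injective]
  congr 1
  ext f
  simp only [Finset.mem_filter, Finset.mem_univ, true_and, Finset.mem_image]
  constructor
  · intro h
    obtain ⟨i, rfl⟩ := (C.mem_iff f).1 h.1
    exact ⟨i, (C.isMinVertex_facet_iff hv hl i).1 h, rfl⟩
  · rintro ⟨i, h, rfl⟩
    exact (C.isMinVertex_facet_iff hv hl i).2 h

/-- Euler's relation for simple 3-polytopes. -/
theorem IsSimpleThreePolytope.two_mul_facets {P : Set Space3} (hP : IsSimpleThreePolytope P) :
    2 * (polytopeFacets P).ncard = (polytopeVertices P).ncard + 4 := by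
  classical
  have hV := hP.polytope.finite_vertices
  have hFfin : (polytopeFacets P).Finite := hP.polytope.finite_faces 2
  have : Fintype (polytopeFacets P) := hFfin.fintype
  obtain ⟨l, hl⟩ := exists_dual_injOn hV
  have hl' : Set.InjOn (-l) (polytopeVertices P) := fun x hx y hy h =>
    hl hx hy (by simpa using h)
  have hcount : ∀ m : Module.Dual ℝ Space3, Set.InjOn m (polytopeVertices P) →
      ∑ v ∈ hV.toFinset, (Finset.univ.filter fun f : polytopeFacets P => IsMinVertex P m f v).card =
        (polytopeFacets P).ncard := by
    intro m hm
    have h1 := Finset.sum_card_bipartiteAbove_eq_sum_card_bipartiteBelow (s := hV.toFinset)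
      (t := (Finset.univ : Finset (polytopeFacets P)))
      (fun v (f : polytopeFacets P) => IsMinVertex P m f v)
    refine h1.trans ?_
    refine (Finset.sum_congr rfl fun f _ =>
      hP.polytope.card_filter_isMinVertex hm f.2.1 f.2.2.1).trans ?_
    rw [Finset.sum_const, smul_eq_mul, mul_one, Finset.card_univ, ← Nat.card_eq_fintype_card,
      Nat.card_coe_set_eq]
  have hext : ∀ m : Module.Dual ℝ Space3, Set.InjOn m (polytopeVertices P) →
      ∑ v ∈ hV.toFinset, (if IsMinVertex P m P v then 2 else 0) = 2 := by
    intro m hm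
    rw [← Finset.sum_filter, Finset.sum_const,
      hP.polytope.card_filter_isMinVertex hm (IsExposed.refl (𝕜 := ℝ) P) hP.nonempty]
    rfl
  -- Summed over the vertices, the left side is 2F, one lowest and one highest vertex per facet; the
  -- right side is V + 2 + 2, from the unique global minimum and maximum.
  have hlocal : ∀ v ∈ hV.toFinset,
      (Finset.univ.filter fun f : polytopeFacets P => IsMinVertex P l f v).card +
      (Finset.univ.filter fun f : polytopeFacets P => IsMinVertex P (-l) f v).card =
      1 + ((if IsMinVertex P l P v then 2 else 0) + if IsMinVertex P (-l) P v then 2 else 0) := by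
    intro v hv
    rw [Set.Finite.mem_toFinset] at hv
    obtain ⟨C⟩ := hP.nonempty_vertexChart hv
    rw [C.card_filter_isMinVertex hv hl, C.card_filter_isMinVertex hv hl']
    simp only [C.isMinVertex_self_iff hv hl, C.isMinVertex_self_iff hv hl']
    have hb := card_filter_sign fun j => decide (l v < l (C.w j))
    have hneg : ∀ j, (-l) v < (-l) (C.w j) ↔ ¬ l v < l (C.w j) := fun j => by
      simp only [LinearMap.neg_apply, neg_lt_neg_iff, not_lt]
      exact ⟨le_of_lt, fun h => lt_of_le_of_ne h fun heq => C.w_ne j (hl (C.w_mem j) hv heq)⟩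
    simp only [decide_eq_true_eq, decide_eq_false_iff_not] at hb
    simp only [hneg]
    convert hb using 2
  have := Finset.sum_congr rfl hlocal
  simp only [Finset.sum_add_distrib, hcount l hl, hcount (-l) hl', hext l hl, hext (-l) hl'] at this
  rw [Set.ncard_eq_toFinset_card _ hV]
  simp at this
  omega

/-! ### Colour classes and linear relations between incidence vectors. -/

section Coloring

variable {P : Set Space3} {v : Space3} {c : polytopeFacets P → Fin 3}

/-- Any two of the facets at `v` share the edge opposite to the third, so the three colours differ.
-/
theorem VertexChart.bijective_color (C : VertexChart P v) (hP : IsConvexPolytope P)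
    (hv : v ∈ polytopeVertices P) (hc : IsProperColoring P c) :
    Function.Bijective fun i => c (C.facet i) := by
  refine Finite.injective_iff_bijective.1 fun i j h => ?_
  by_contra hne
  obtain ⟨k, hki, hkj⟩ : ∃ k : Fin 3, i ≠ k ∧ j ≠ k :=
    (by decide : ∀ i j : Fin 3, ∃ k, i ≠ k ∧ j ≠ k) i j
  exact hc _ _ (fun h => hne (C.facet_injective h))
    ⟨_, C.edge_mem_polytopeEdges hP hv k, C.edge_subset_facet hki, C.edge_subset_facet hkj⟩ h

namespace IsSimpleThreePolytope

theorem existsUnique_facet (hP : IsSimpleThreePolytope P) (hc : IsProperColoring P c)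
    (hv : v ∈ polytopeVertices P) (k : Fin 3) :
    ∃! f : polytopeFacets P, v ∈ (f : Set Space3) ∧ c f = k := by
  obtain ⟨C⟩ := hP.nonempty_vertexChart hv
  have hb := C.bijective_color hP.polytope hv hc
  obtain ⟨i, hi⟩ := hb.2 k
  refine ⟨C.facet i, ⟨C.mem_facet i, hi⟩, ?_⟩
  rintro f ⟨hf, hfk⟩
  obtain ⟨j, rfl⟩ := (C.mem_iff f).1 hf
  rw [hb.1 (hfk.trans hi.symm)]

/-- The far end of the edge that leaves a facet of colour `k` lies on another facet of that colour.
-/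
theorem two_le_colorCount (hP : IsSimpleThreePolytope P) (hc : IsProperColoring P c)
    (k : Fin 3) : 2 ≤ colorCount c k := by
  obtain ⟨v, hv⟩ := hP.vertices_nonempty
  obtain ⟨C⟩ := hP.nonempty_vertexChart hv
  obtain ⟨i, hi⟩ := (C.bijective_color hP.polytope hv hc).2 k
  obtain ⟨g, ⟨hg, hgk⟩, -⟩ := hP.existsUnique_facet hc (C.w_mem i) k
  have hne : C.facet i ≠ g := fun h => C.w_notMem_facet i (h ▸ hg)
  have : Finite (polytopeFacets P) := (hP.polytope.finite_faces 2).to_subtype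
  rw [colorCount, ← Set.ncard_pair hne]
  refine Set.ncard_le_ncard ?_
  rintro f (rfl | rfl)
  · exact hi
  · exact hgk

/-- The linear relations between the incidence vectors are the obvious ones. -/
theorem relation_eq_color [Fintype (polytopeFacets P)] (hP : IsSimpleThreePolytope P)
    (hc : IsProperColoring P c)
    {a : polytopeFacets P → ℝ} (ha : ∑ f, a f • incidenceVector P f = 0) :
    ∃ t : Fin 3 → ℝ, ∑ k, t k = 0 ∧ ∀ f, a f = t (c f) := by
  classical
  have : Nonempty (polytopeFacets P) := by
    obtain ⟨v, hv⟩ := hP.vertices_nonempty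
    exact (hP.existsUnique_facet hc hv 0).exists.nonempty
  choose! φ hφ huniq using fun v (hv : v ∈ polytopeVertices P) (k : Fin 3) =>
    hP.existsUnique_facet hc hv k
  have hsum : ∀ v ∈ polytopeVertices P, ∑ k, a (φ v k) = 0 := by
    intro v hv
    have h1 := congrFun ha ⟨v, hv⟩
    rw [Finset.sum_apply] at h1
    simp only [Pi.smul_apply, smul_eq_mul, incidenceVector, mul_ite, mul_one, mul_zero,
      Pi.zero_apply] at h1
    rw [← Finset.sum_filter] at h1
    rw [← h1]
    refine Finset.sum_bij (fun k _ => φ v k) ?_ ?_ ?_ ?_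
    · intro k _
      simpa using (hφ v hv k).1
    · intro k _ k' _ h
      rw [← (hφ v hv k).2, h, (hφ v hv k').2]
    · intro f hf
      exact ⟨c f, Finset.mem_univ _,
        (huniq v hv (c f) f ⟨by simpa using hf, rfl⟩).symm⟩
    · exact fun _ _ => rfl
  have hV := hP.polytope.finite_vertices
  obtain ⟨l, hl⟩ := exists_dual_injOn hV
  obtain ⟨z, hz, hzmax⟩ := Set.exists_max_image _ l hV hP.vertices_nonempty
  have key : ∀ v ∈ polytopeVertices P, ∀ k, a (φ v k) = a (φ z k) := by
    by_contra! hcon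
    -- At a highest bad vertex some edge ascends to a good one. Two of the three facets persist
    -- along it, and the vanishing sums force the third coefficients to agree.
    obtain ⟨v, ⟨hv, k₁, hk₁⟩, hvmax⟩ := Set.exists_max_image
      {v | v ∈ polytopeVertices P ∧ ∃ k, a (φ v k) ≠ a (φ z k)} l
      (hV.subset fun v hv => hv.1) hcon
    obtain ⟨C⟩ := hP.nonempty_vertexChart hv
    have hvz : l v < l z := lt_of_le_of_ne (hzmax v hv) fun h => by
      have := hl hv hz h
      exact hk₁ (by rw [this])
    obtain ⟨i, hi⟩ := C.exists_lt_of_lt hz.1 hvz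
    have hw : ∀ k, a (φ (C.w i) k) = a (φ z k) := by
      by_contra! hcon
      exact absurd (hvmax _ ⟨C.w_mem i, hcon⟩) (not_le.2 hi)
    have hne : ∀ k, k ≠ c (C.facet i) → a (φ v k) = a (φ (C.w i) k) := by
      intro k hk
      obtain ⟨j, hj⟩ := (C.bijective_color hP.polytope hv hc).2 k
      have hji : j ≠ i := fun h => hk (by rw [← hj, h])
      rw [← huniq v hv k (C.facet j) ⟨C.mem_facet j, hj⟩,
        ← huniq _ (C.w_mem i) k (C.facet j) ⟨C.w_mem_facet hji.symm, hj⟩]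
    have h1 := hsum v hv
    have h2 := hsum _ (C.w_mem i)
    rw [← Finset.add_sum_erase _ _ (Finset.mem_univ (c (C.facet i)))] at h1 h2
    rw [Finset.sum_congr rfl fun k hk => hne k (Finset.ne_of_mem_erase hk)] at h1
    apply hk₁
    rw [← hw]
    by_cases hk : k₁ = c (C.facet i)
    · rw [hk]
      linarith
    · exact hne _ hk
  refine ⟨fun k => a (φ z k), hsum z hz, fun f => ?_⟩
  obtain ⟨v, hv, hvf⟩ := hP.polytope.exists_vertex_mem f.2.1 f.2.2.1
  beta_reduce
  rw [← key v hv, ← huniq v hv (c f) f ⟨hvf, rfl⟩]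

open Classical in
theorem sum_incidenceVector [Fintype (polytopeFacets P)] (hP : IsSimpleThreePolytope P)
    (hc : IsProperColoring P c) (k : Fin 3) :
    ∑ f with c f = k, incidenceVector P f = 1 := by
  ext ⟨v, hv⟩
  rw [Finset.sum_apply]
  obtain ⟨g, ⟨hg, hgk⟩, huniq⟩ := hP.existsUnique_facet hc hv k
  rw [Finset.sum_eq_single g]
  · simp [incidenceVector, hg]
  · intro f hf hfg
    have : v ∉ (f : Set Space3) := fun h => hfg (huniq f ⟨h, (Finset.mem_filter.1 hf).2⟩)
    simp [incidenceVector, this]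
  · intro h
    simp [hgk] at h

open Classical in
/-- Prescribed values on the incidence vectors extend to a linear functional when their sums over
the colour classes agree. -/
theorem exists_functional [Fintype (polytopeFacets P)] (hP : IsSimpleThreePolytope P)
    (hc : IsProperColoring P c) {h : polytopeFacets P → ℝ} {s : ℝ}
    (hs : ∀ k, ∑ f with c f = k, h f = s) :
    ∃ l : StrongDual ℝ (polytopeVertices P → ℝ), ∀ f : polytopeFacets P, l (incidenceVector P f) = h f := by
  have : Finite (polytopeVertices P) := hP.polytope.finite_vertices.to_subtype
  let T := Fintype.linearCombination ℝ fun f : polytopeFacets P => incidenceVector P (f : Set Space3)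
  let H := Fintype.linearCombination ℝ h
  -- The values `h` are induced by a functional iff `H` kills every relation, that is, the kernel of
  -- `T`.
  have hmem : H ∈ LinearMap.range T.dualMap := by
    rw [LinearMap.range_dualMap_eq_dualAnnihilator_ker, Submodule.mem_dualAnnihilator]
    intro a ha
    obtain ⟨t, ht, hat⟩ := hP.relation_eq_color hc (a := a) (by
      simpa [T, Fintype.linearCombination_apply] using ha)
    simp only [H, Fintype.linearCombination_apply, smul_eq_mul]
    rw [← Finset.sum_fiberwise (g := c)]
    calc ∑ k, ∑ f with c f = k, a f * h f = ∑ k, t k * s := by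
          refine Finset.sum_congr rfl fun k _ => ?_
          rw [← hs k, Finset.mul_sum]
          refine Finset.sum_congr rfl fun f hf => ?_
          rw [hat, (Finset.mem_filter.1 hf).2]
      _ = 0 := by rw [← Finset.sum_mul, ht, zero_mul]
  obtain ⟨l, hl⟩ := hmem
  refine ⟨LinearMap.toContinuousLinearMap l, fun f => ?_⟩
  have := LinearMap.congr_fun hl (Pi.single f 1)
  simpa [T, H, Fintype.linearCombination_apply_single] using this

end IsSimpleThreePolytope

end Coloring

/-! ### Faces of the hull in terms of class sizes. -/

/-- The sets of facets that span a face of the incidence hull, in terms of the colouring. -/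
def IsColorFace {X : Type*} (c : X → Fin 3) (S : Set X) : Prop :=
  ∃ α β : ℝ, ∀ k, 0 ≤ α + β * ({x | c x = k}.ncard : ℝ) ∧
    (α + β * ({x | c x = k}.ncard : ℝ) = 0 ↔ ∀ x, c x = k → x ∈ S)

namespace IsSimpleThreePolytope

variable {P : Set Space3} {c : polytopeFacets P → Fin 3}

/-- The facets of `P` whose incidence vectors lie in `F`. -/
def incidentFacets (P : Set Space3) (F : Set (polytopeVertices P → ℝ)) :
    Set (polytopeFacets P) :=
  {f | incidenceVector P f ∈ F}

theorem incidenceVector_mem_hull (f : polytopeFacets P) :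
    incidenceVector P f ∈ incidenceHull P :=
  subset_convexHull ℝ _ ⟨f, f.2, rfl⟩

theorem incidentFacets_subset_iff (hP : IsSimpleThreePolytope P)
    {F G : Set (polytopeVertices P → ℝ)} (hF : IsExposed ℝ (incidenceHull P) F)
    (hG : IsExposed ℝ (incidenceHull P) G) :
    incidentFacets P F ⊆ incidentFacets P G ↔ F ⊆ G := by
  refine ⟨fun h => ?_, fun h f hf => h hf⟩
  have hfin : (incidenceVector P '' polytopeFacets P).Finite :=
    (hP.polytope.finite_faces 2).image _
  rw [IsExposed.eq_convexHull_inter hfin hF]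
  refine convexHull_min ?_ (hG.convex (convex_convexHull ℝ _))
  rintro _ ⟨⟨f, hf, rfl⟩, hfF⟩
  exact h (a := ⟨f, hf⟩) hfF

-- Each class sums to the all-ones vector, so the deficits of an exposing functional `l` with
-- maximum `l x` sum over class k to `-l 1 + l x * n_k`; being nonnegative, they sum to zero only if
-- all vanish.
open Classical in
theorem isColorFace_incidentFacets (hP : IsSimpleThreePolytope P) (hc : IsProperColoring P c)
    {F : Set (polytopeVertices P → ℝ)} (hF : IsExposed ℝ (incidenceHull P) F) :
    IsColorFace c (incidentFacets P F) := by
  have : Fintype (polytopeFacets P) := (hP.polytope.finite_faces 2).fintype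
  rcases F.eq_empty_or_nonempty with rfl | ⟨x, hx⟩
  -- The empty face needs no functional: the constant 1 works since no class is empty.
  · refine ⟨1, 0, fun k => ?_⟩
    simp only [zero_mul, add_zero, zero_le_one, one_ne_zero, false_iff, true_and]
    intro h
    have h2 := hP.two_le_colorCount hc k
    obtain ⟨f, hf⟩ := Set.nonempty_of_ncard_ne_zero (s := {f | c f = k}) (by
      rw [colorCount] at h2; omega)
    exact (h f hf : incidenceVector P f ∈ (∅ : Set (polytopeVertices P → ℝ)))
  · obtain ⟨l, rfl⟩ := hF ⟨x, hx⟩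
    have hle : ∀ f : polytopeFacets P, 0 ≤ l x - l (incidenceVector P f) := fun f =>
      sub_nonneg.2 (hx.2 _ (incidenceVector_mem_hull f))
    have hmem : ∀ f : polytopeFacets P, f ∈ incidentFacets P {x | x ∈ incidenceHull P ∧
        ∀ y ∈ incidenceHull P, l y ≤ l x} ↔ l x - l (incidenceVector P f) = 0 := by
      intro f
      constructor
      · intro h
        linarith [h.2 x hx.1, hle f]
      · intro h
        exact ⟨incidenceVector_mem_hull f, fun y hy => by linarith [hx.2 y hy]⟩
    refine ⟨-l 1, l x, fun k => ?_⟩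
    have hsum : -l 1 + l x * ({f : polytopeFacets P | c f = k}.ncard : ℝ) =
        ∑ f with c f = k, (l x - l (incidenceVector P f)) := by
      rw [Finset.sum_sub_distrib, ← hP.sum_incidenceVector hc k, map_sum, Finset.sum_const,
        nsmul_eq_mul, Set.ncard_eq_toFinset_card', Set.toFinset_ofPred]
      ring
    rw [hsum]
    refine ⟨Finset.sum_nonneg fun f _ => hle f, ?_⟩
    rw [Finset.sum_eq_zero_iff_of_nonneg fun f _ => hle f]
    simp only [Finset.mem_filter, Finset.mem_univ, true_and, hmem]

open Classical in
theorem exists_incidentFacets_eq (hP : IsSimpleThreePolytope P) (hc : IsProperColoring P c)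
    {S : Set (polytopeFacets P)} (hS : IsColorFace c S) :
    ∃ F, IsExposed ℝ (incidenceHull P) F ∧ incidentFacets P F = S := by
  have : Fintype (polytopeFacets P) := (hP.polytope.finite_faces 2).fintype
  rcases S.eq_empty_or_nonempty with rfl | ⟨f₀, hf₀⟩
  · exact ⟨∅, isExposed_empty, rfl⟩
  obtain ⟨α, β, hαβ⟩ := hS
  set G : Fin 3 → ℝ := fun k => α + β * ({f : polytopeFacets P | c f = k}.ncard : ℝ) with hG
  let n : Fin 3 → Finset (polytopeFacets P) := fun k => {f | c f = k ∧ f ∉ S}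
  have hn : ∀ f, f ∉ S → 0 < ((n (c f)).card : ℝ) := fun f hf => by
    exact_mod_cast Finset.card_pos.2 ⟨f, by simp [n, hf]⟩
  -- The required class total `G k` is spread evenly over the members of class k outside `S`.
  let g : polytopeFacets P → ℝ := fun f => if f ∈ S then 0 else G (c f) / (n (c f)).card
  have hg0 : ∀ f, 0 ≤ g f := fun f => by
    by_cases hf : f ∈ S
    · simp [g, hf]
    · simp only [g, hf, if_false]
      exact div_nonneg (hαβ (c f)).1 (Nat.cast_nonneg _)
  have hgS : ∀ f, g f = 0 ↔ f ∈ S := fun f => by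
    by_cases hf : f ∈ S
    · simp [g, hf]
    · simp only [g, hf, if_false, iff_false]
      refine div_ne_zero (fun h => hf ?_) (hn f hf).ne'
      exact ((hαβ (c f)).2.1 h) f rfl
  have hgsum : ∀ k, ∑ f with c f = k, g f = G k := by
    intro k
    have h1 : ∑ f with c f = k, g f = ∑ f ∈ n k, G k / (n k).card := by
      rw [← Finset.sum_filter_add_sum_filter_not _ (· ∈ S),
        Finset.sum_eq_zero (s := Finset.filter (· ∈ S) _)
          (fun f hf => (hgS f).2 (Finset.mem_filter.1 hf).2), zero_add, Finset.filter_filter]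
      refine Finset.sum_congr rfl fun f hf => ?_
      simp only [n, Finset.mem_filter, Finset.mem_univ, true_and] at hf
      simp [g, hf.2, hf.1]
    rw [h1, Finset.sum_const, nsmul_eq_mul]
    -- If nothing lies outside `S`, the class is contained in `S` and its total is zero anyway.
    by_cases hk : (n k).card = 0
    · rw [Finset.card_eq_zero] at hk
      have : G k = 0 := (hαβ k).2.2 fun f hf => by
        by_contra hfS
        have : f ∈ n k := by simp [n, hf, hfS]
        simp [hk] at this
      rw [this]
      simp
    · field_simp
  -- The class sums `β * n_k - (α + β * n_k) = -α` do not depend on k.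
  obtain ⟨l, hl⟩ := hP.exists_functional hc (h := fun f => β - g f) (s := -α) (by
    intro k
    rw [Finset.sum_sub_distrib, hgsum, Finset.sum_const, nsmul_eq_mul]
    simp only [hG]
    rw [Set.ncard_eq_toFinset_card', Set.toFinset_ofPred]
    ring)
  have hle : ∀ y ∈ incidenceHull P, l y ≤ β := by
    have : incidenceHull P ⊆ {y | l y ≤ β} := by
      refine convexHull_min ?_ (convex_halfSpace_le l.toLinearMap.isLinear β)
      rintro _ ⟨f, hf, rfl⟩
      have := hl ⟨f, hf⟩
      have h0 := hg0 ⟨f, hf⟩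
      simp only [Set.mem_ofPred_eq] at this ⊢
      linarith
    exact this
  refine ⟨_, ContinuousLinearMap.toExposed.isExposed (l := l), ?_⟩
  ext f
  have hf₀' : l (incidenceVector P f₀) = β := by rw [hl, (hgS f₀).2 hf₀, sub_zero]
  rw [← hgS]
  constructor
  · intro h
    have h1 := h.2 _ (incidenceVector_mem_hull f₀)
    rw [hf₀', hl] at h1
    linarith [hg0 f]
  · intro h
    refine ⟨incidenceVector_mem_hull f, fun y hy => ?_⟩
    rw [hl, h, sub_zero]
    exact hle y hy

/-- The face lattice of the incidence hull. -/
theorem nonempty_facePoset_orderIso (hP : IsSimpleThreePolytope P) (hc : IsProperColoring P c) :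
    Nonempty (FacePoset (incidenceHull P) ≃o {S // IsColorFace c S}) := by
  let φ : FacePoset (incidenceHull P) ↪o {S // IsColorFace c S} :=
    OrderEmbedding.ofMapLEIff
      (fun F => ⟨incidentFacets P F.1, hP.isColorFace_incidentFacets hc F.2⟩)
      fun F G => hP.incidentFacets_subset_iff F.2 G.2
  refine ⟨RelIso.ofSurjective φ ?_⟩
  rintro ⟨S, hS⟩
  obtain ⟨F, hF, rfl⟩ := hP.exists_incidentFacets_eq hc hS
  exact ⟨⟨F, hF⟩, rfl⟩

end IsSimpleThreePolytope

/-! ### Isomorphisms between families of sets. -/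

section Families

variable {X Y : Type*} {p : Set X → Prop} {q : Set Y → Prop}

/-- The singletons are the atoms above the least element `∅`, and isomorphisms preserve atoms. -/
theorem exists_orderIso_singleton (hp0 : p ∅) (hp1 : ∀ x, p {x}) (hq0 : q ∅)
    (hq1 : ∀ y, q {y}) (e : {S // p S} ≃o {S // q S}) (x : X) :
    ∃ y, e ⟨{x}, hp1 x⟩ = ⟨{y}, hq1 y⟩ := by
  have hne : (e ⟨{x}, hp1 x⟩ : Set Y).Nonempty := by
    rw [Set.nonempty_iff_ne_empty]
    intro h
    have h1 : e ⟨{x}, hp1 x⟩ ≤ ⟨∅, hq0⟩ := h.le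
    have h2 : (⟨{x}, hp1 x⟩ : {S // p S}) ≤ ⟨∅, hp0⟩ := by
      rw [← e.le_iff_le]
      exact h1.trans (Set.empty_subset _ : (∅ : Set Y) ⊆ _)
    exact h2 (Set.mem_singleton x)
  obtain ⟨y, hy⟩ := hne
  refine ⟨y, le_antisymm ?_ (Set.singleton_subset_iff.2 hy)⟩
  have h1 : e.symm ⟨{y}, hq1 y⟩ ≤ ⟨{x}, hp1 x⟩ := by
    rw [e.symm_apply_le]
    exact Set.singleton_subset_iff.2 hy
  rcases Set.subset_singleton_iff_eq.1 (h1 : (e.symm ⟨{y}, hq1 y⟩ : Set X) ⊆ {x}) with h | h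
  · exfalso
    have h2 : e.symm ⟨{y}, hq1 y⟩ ≤ ⟨∅, hp0⟩ := h.le
    have h3 : (⟨{y}, hq1 y⟩ : {S // q S}) ≤ ⟨∅, hq0⟩ := by
      rw [← e.symm.le_iff_le]
      exact h2.trans (Set.empty_subset _ : (∅ : Set X) ⊆ _)
    exact h3 (Set.mem_singleton y)
  · rw [← e.le_symm_apply]
    exact h.ge

/-- An isomorphism of families of sets that contain all singletons is induced by a bijection of
the underlying sets. -/
theorem exists_equiv_of_orderIso (hp0 : p ∅) (hp1 : ∀ x, p {x}) (hq0 : q ∅)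
    (hq1 : ∀ y, q {y}) (e : {S // p S} ≃o {S // q S}) :
    ∃ τ : X ≃ Y, ∀ S, p S ↔ q (τ '' S) := by
  choose f hf using exists_orderIso_singleton hp0 hp1 hq0 hq1 e
  choose g hg using exists_orderIso_singleton hq0 hq1 hp0 hp1 e.symm
  have hgf : Function.LeftInverse g f := fun x => by
    have h := hg (f x)
    rw [← hf, e.symm_apply_apply, Subtype.mk.injEq, Set.singleton_eq_singleton_iff] at h
    exact h.symm
  have hfg : Function.RightInverse g f := fun y => by
    have h := hf (g y)
    rw [← hg, e.apply_symm_apply, Subtype.mk.injEq, Set.singleton_eq_singleton_iff] at h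
    exact h.symm
  let τ : X ≃ Y := ⟨f, g, hgf, hfg⟩
  have himage : ∀ S (hS : p S), (e ⟨S, hS⟩ : Set Y) = τ '' S := by
    intro S hS
    ext y
    have h1 : y ∈ (e ⟨S, hS⟩ : Set Y) ↔ (⟨{y}, hq1 y⟩ : {S // q S}) ≤ e ⟨S, hS⟩ :=
      Set.singleton_subset_iff.symm
    have h2 : τ.symm y ∈ S ↔ (⟨{g y}, hp1 (g y)⟩ : {S // p S}) ≤ ⟨S, hS⟩ :=
      Set.singleton_subset_iff.symm
    rw [h1, Equiv.image_eq_preimage_symm, Set.mem_preimage, h2, ← e.symm_apply_le, hg]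
  refine ⟨τ, fun S => ⟨fun hS => himage S hS ▸ (e ⟨S, hS⟩).2, fun hS => ?_⟩⟩
  have h := himage _ (e.symm ⟨τ '' S, hS⟩).2
  rw [Subtype.coe_eta, e.apply_symm_apply] at h
  rw [τ.injective.image_injective h]
  exact (e.symm ⟨τ '' S, hS⟩).2

theorem nonempty_orderIso_of_equiv (τ : X ≃ Y) (h : ∀ S, p S ↔ q (τ '' S)) :
    Nonempty ({S // p S} ≃o {S // q S}) := by
  let φ : {S // p S} ↪o {S // q S} :=
    OrderEmbedding.ofMapLEIff (fun S => ⟨τ '' S.1, (h S.1).1 S.2⟩)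
      fun S T => Set.image_subset_image_iff τ.injective
  refine ⟨RelIso.ofSurjective φ ?_⟩
  rintro ⟨T, hT⟩
  have hTT : τ '' (τ ⁻¹' T) = T := Set.image_preimage_eq T τ.surjective
  exact ⟨⟨τ ⁻¹' T, (h _).2 (by rwa [hTT])⟩, Subtype.ext hTT⟩

theorem exists_equiv_of_ncard_fiber_eq {ι : Type*} [Finite X] [Finite Y] {c : X → ι} {d : Y → ι}
    (h : ∀ k, {x | c x = k}.ncard = {y | d y = k}.ncard) :
    ∃ τ : X ≃ Y, ∀ x, d (τ x) = c x := by
  have he : ∀ k, Nonempty ({x // c x = k} ≃ {y // d y = k}) := fun k => Finite.card_eq.1 (h k)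
  let e := fun k => (he k).some
  refine ⟨(Equiv.sigmaFiberEquiv c).symm.trans
    ((Equiv.sigmaCongrRight e).trans (Equiv.sigmaFiberEquiv d)), fun x => ?_⟩
  exact (e (c x) ⟨x, rfl⟩).2

end Families

/-! ### Faces and smallest non-faces for given class sizes. -/

section ColorFace

variable {X Y : Type*} {c : X → Fin 3} {d : Y → Fin 3}

theorem isColorFace_perm_comp (σ : Equiv.Perm (Fin 3)) (c : X → Fin 3) (S : Set X) :
    IsColorFace (σ ∘ c) S ↔ IsColorFace c S := by
  unfold IsColorFace
  refine exists_congr fun α => exists_congr fun β => ?_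
  rw [← σ.forall_congr_right]
  simp

theorem sum_ncard_fiber [Finite X] (c : X → Fin 3) :
    {x | c x = 0}.ncard + {x | c x = 1}.ncard + {x | c x = 2}.ncard = Nat.card X := by
  classical
  have := Fintype.ofFinite X
  have h := Finset.card_eq_sum_card_fiberwise (f := c) (s := Finset.univ) (t := Finset.univ)
    (fun _ _ => Finset.mem_coe.2 (Finset.mem_univ _))
  rw [Fin.sum_univ_three, Finset.card_univ, ← Nat.card_eq_fintype_card] at h
  simp only [h, Set.ncard_eq_toFinset_card', Set.toFinset_ofPred]

theorem fiber_subset_of_ncard_le [Finite X] {S : Set X} {k : Fin 3} (h : S.ncard < {x | c x = k}.ncard) :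
    ¬ ∀ x, c x = k → x ∈ S := fun hS =>
  absurd (Set.ncard_le_ncard (s := {x | c x = k}) (t := S) hS) (not_le.2 h)

theorem isColorFace_of_ncard_lt_two [Finite X] (hc : ∀ k, 2 ≤ {x | c x = k}.ncard) {S : Set X}
    (hS : S.ncard < 2) : IsColorFace c S := by
  refine ⟨1, 0, fun k => ?_⟩
  simp [fiber_subset_of_ncard_le (hS.trans_le (hc k))]

/-- A colour class is not a face if some other class has the same size. -/
theorem not_isColorFace_fiber_of_eq (hc : ∀ k, 2 ≤ {x | c x = k}.ncard) {i j : Fin 3}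
    (hij : i ≠ j) (h : {x | c x = i}.ncard = {x | c x = j}.ncard) :
    ¬ IsColorFace c {x | c x = i} := by
  rintro ⟨α, β, hαβ⟩
  obtain ⟨x, hx⟩ := Set.nonempty_of_ncard_ne_zero (s := {x | c x = j}) (by have := hc j; omega)
  have h1 := (hαβ i).2.2 fun x hx => hx
  rw [h] at h1
  have h2 : c x = i := (hαβ j).2.1 h1 x hx
  exact hij (h2.symm.trans hx)

/-- An affine function positive at n_0 and n_2 cannot vanish at n_1 between them. -/
theorem not_isColorFace_fiber_one (hc : ∀ k, 2 ≤ {x | c x = k}.ncard)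
    (h01 : {x | c x = 0}.ncard ≤ {x | c x = 1}.ncard)
    (h12 : {x | c x = 1}.ncard ≤ {x | c x = 2}.ncard) :
    ¬ IsColorFace c {x | c x = 1} := by
  rintro ⟨α, β, hαβ⟩
  have hpos : ∀ j, j ≠ 1 → 0 < α + β * ({x | c x = j}.ncard : ℝ) := fun j hj => by
    refine lt_of_le_of_ne (hαβ j).1 fun h => ?_
    obtain ⟨x, hx⟩ := Set.nonempty_of_ncard_ne_zero (s := {x | c x = j})
      (by have := hc j; omega)
    have h2 : c x = 1 := (hαβ j).2.1 h.symm x hx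
    exact hj (hx.symm.trans h2)
  have h0 := hpos 0 (by decide)
  have h2 := hpos 2 (by decide)
  have h1 := (hαβ 1).2.2 fun x hx => hx
  have h01' : ({x | c x = 0}.ncard : ℝ) ≤ {x | c x = 1}.ncard := by exact_mod_cast h01
  have h12' : ({x | c x = 1}.ncard : ℝ) ≤ {x | c x = 2}.ncard := by exact_mod_cast h12
  rcases le_total 0 β with hβ | hβ
  · nlinarith
  · nlinarith

/-- The witness is t ↦ t - n_0 if `S` contains class 0, and the constant 1 otherwise. -/
theorem isColorFace_of_not_subset {S : Set X}
    (h12 : {x | c x = 1}.ncard ≤ {x | c x = 2}.ncard)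
    (h0 : (∀ x, c x = 0 → x ∈ S) → {x | c x = 0}.ncard < {x | c x = 1}.ncard)
    (h1 : ¬ ∀ x, c x = 1 → x ∈ S) (h2 : ¬ ∀ x, c x = 2 → x ∈ S) : IsColorFace c S := by
  by_cases h : ∀ x, c x = 0 → x ∈ S
  · have hlt : ({x | c x = 0}.ncard : ℝ) < {x | c x = 1}.ncard := by exact_mod_cast h0 h
    have hle : ({x | c x = 1}.ncard : ℝ) ≤ {x | c x = 2}.ncard := by exact_mod_cast h12
    refine ⟨-({x | c x = 0}.ncard : ℝ), 1, Fin.forall_fin_succ.2 ⟨?_, Fin.forall_fin_two.2 ⟨?_, ?_⟩⟩⟩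
    · simpa using h
    · refine ⟨?_, iff_of_false (fun h => ?_) h1⟩
      · simp only [Fin.succ_zero_eq_one]; linarith
      · simp only [Fin.succ_zero_eq_one] at h; linarith
    · refine ⟨?_, iff_of_false (fun h => ?_) h2⟩
      · simp only [Fin.succ_one_eq_two]; linarith
      · simp only [Fin.succ_one_eq_two] at h; linarith
  · refine ⟨1, 0, fun k => ?_⟩
    fin_cases k <;> simp_all

/-- A set with fewer than n_1 elements contains neither class 1 nor class 2, and contains class 0
only if n_0 < n_1. -/
theorem le_ncard_of_not_isColorFace [Finite X] {S : Set X}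
    (h12 : {x | c x = 1}.ncard ≤ {x | c x = 2}.ncard) (hS : ¬ IsColorFace c S) :
    {x | c x = 1}.ncard ≤ S.ncard := by
  by_contra! h
  refine hS (isColorFace_of_not_subset h12 (fun h0 => ?_) (fiber_subset_of_ncard_le h)
    (fiber_subset_of_ncard_le (h.trans_le h12)))
  exact (Set.ncard_le_ncard (s := {x | c x = 0}) (t := S) h0).trans_lt h

/-- The smallest set which is not a face is unique exactly if the class sizes are distinct. -/
theorem unique_minimal_nonface_iff [Finite X] (hc : ∀ k, 2 ≤ {x | c x = k}.ncard)
    (h01 : {x | c x = 0}.ncard ≤ {x | c x = 1}.ncard)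
    (h12 : {x | c x = 1}.ncard ≤ {x | c x = 2}.ncard) :
    (∀ S T : Set X, ¬ IsColorFace c S → ¬ IsColorFace c T → S.ncard = {x | c x = 1}.ncard →
      T.ncard = {x | c x = 1}.ncard → S = T) ↔
    {x | c x = 0}.ncard < {x | c x = 1}.ncard ∧ {x | c x = 1}.ncard < {x | c x = 2}.ncard := by
  have hdisj : ∀ j, j ≠ 1 → {x | c x = j} ≠ {x | c x = 1} := fun j hj h => by
    obtain ⟨x, hx⟩ := Set.nonempty_of_ncard_ne_zero (s := {x | c x = j})
      (by have := hc j; omega)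
    have hx1 : x ∈ {x | c x = 1} := h ▸ hx
    exact hj (hx.symm.trans hx1)
  have hone := not_isColorFace_fiber_one hc h01 h12
  constructor
  · intro h
    refine ⟨lt_of_le_of_ne h01 fun heq => ?_, lt_of_le_of_ne h12 fun heq => ?_⟩
    · exact hdisj 0 (by decide)
        (h _ _ (not_isColorFace_fiber_of_eq hc (by decide) heq) hone heq rfl)
    · exact hdisj 2 (by decide)
        (h _ _ (not_isColorFace_fiber_of_eq hc (by decide) heq.symm) hone heq.symm rfl)
  · rintro ⟨h0, h2⟩
    have key : ∀ S : Set X, ¬ IsColorFace c S → S.ncard = {x | c x = 1}.ncard →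
        S = {x | c x = 1} := by
      intro S hS hcard
      by_contra hne
      refine hS (isColorFace_of_not_subset h12 (fun _ => h0) (fun hsub => hne ?_)
        (fiber_subset_of_ncard_le (hcard ▸ h2)))
      exact (Set.eq_of_subset_of_ncard_le (s := {x | c x = 1}) (t := S) hsub hcard.le).symm
    exact fun S T hS hT h1 h2 => (key S hS h1).trans (key T hT h2).symm

/-- An affine function nonnegative at n_0 and n_2 that vanishes strictly between them is zero, as is
one vanishing at both. The resulting criterion no longer distinguishes classes 0 and 2. -/
theorem isColorFace_iff_of_lt [Finite X]
    (h01 : {x | c x = 0}.ncard < {x | c x = 1}.ncard)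
    (h12 : {x | c x = 1}.ncard < {x | c x = 2}.ncard) (S : Set X) :
    IsColorFace c S ↔ ((∀ x, c x = 1 → x ∈ S) ↔ ∀ x, c x ≠ 1 → x ∈ S) := by
  have h01' : ({x | c x = 0}.ncard : ℝ) < {x | c x = 1}.ncard := by exact_mod_cast h01
  have h12' : ({x | c x = 1}.ncard : ℝ) < {x | c x = 2}.ncard := by exact_mod_cast h12
  have hsplit : (∀ x, c x ≠ 1 → x ∈ S) ↔ (∀ x, c x = 0 → x ∈ S) ∧ ∀ x, c x = 2 → x ∈ S := by
    constructor
    · exact fun h => ⟨fun x hx => h x (by rw [hx]; decide), fun x hx => h x (by rw [hx]; decide)⟩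
    · rintro ⟨h0, h2⟩ x hx
      have : ∀ k : Fin 3, k ≠ 1 → k = 0 ∨ k = 2 := by decide
      exact (this _ hx).elim (h0 x) (h2 x)
  rw [hsplit]
  constructor
  · rintro ⟨α, β, hαβ⟩
    rw [← (hαβ 0).2, ← (hαβ 1).2, ← (hαβ 2).2]
    have g0 := (hαβ 0).1
    have g2 := (hαβ 2).1
    constructor
    · intro h
      have hβ : β = 0 := by
        rcases lt_trichotomy β 0 with hβ | hβ | hβ
        · nlinarith
        · exact hβ
        · nlinarith
      subst hβ
      simpa using h
    · rintro ⟨h0, h2⟩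
      have hβ : β = 0 := by
        have : β * (({x | c x = 2}.ncard : ℝ) - {x | c x = 0}.ncard) = 0 := by linarith
        rcases mul_eq_zero.1 this with h | h
        · exact h
        · linarith
      subst hβ
      simpa using h0
  · intro h
    by_cases h1 : ∀ x, c x = 1 → x ∈ S
    · refine ⟨0, 0, fun k => ?_⟩
      have := h.1 h1
      have h' : ∀ k : Fin 3, ∀ x, c x = k → x ∈ S :=
        Fin.forall_fin_succ.2 ⟨this.1, Fin.forall_fin_two.2 ⟨h1, this.2⟩⟩
      simpa using h' k
    by_cases h2 : ∀ x, c x = 2 → x ∈ S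
    · have h0 : ¬ ∀ x, c x = 0 → x ∈ S := fun h0 => h1 (h.2 ⟨h0, h2⟩)
      -- The function t ↦ n_2 - t vanishes only at the largest class.
      refine ⟨({x | c x = 2}.ncard : ℝ), -1,
        Fin.forall_fin_succ.2 ⟨?_, Fin.forall_fin_two.2 ⟨?_, ?_⟩⟩⟩
      · exact ⟨by linarith, iff_of_false (fun h => by linarith) h0⟩
      · refine ⟨?_, iff_of_false (fun h => ?_) h1⟩
        · simp only [Fin.succ_zero_eq_one]; linarith
        · simp only [Fin.succ_zero_eq_one] at h; linarith
      · simpa using h2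
    · exact isColorFace_of_not_subset h12.le (fun _ => h01) h1 h2

theorem isColorFace_image_iff_of_comp_eq (τ : X ≃ Y) (h : ∀ x, d (τ x) = c x) (S : Set X) :
    IsColorFace d (τ '' S) ↔ IsColorFace c S := by
  have hcard : ∀ k, {y | d y = k}.ncard = {x | c x = k}.ncard := fun k => by
    rw [← Set.ncard_image_of_injective {x | c x = k} τ.injective]
    congr 1
    ext y
    obtain ⟨x, rfl⟩ := τ.surjective y
    simp [h]
  unfold IsColorFace
  simp only [hcard]
  refine exists_congr fun α => exists_congr fun β => forall_congr' fun k =>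
    and_congr_right fun _ => iff_congr Iff.rfl ?_
  rw [← τ.forall_congr_right]
  simp [h]

end ColorFace

/-! ### Classification of the families by total, type and middle size. -/

section Classification

variable {X Y : Type*} {c : X → Fin 3} {d : Y → Fin 3}

theorem ncard_one_le_of_equiv [Finite X] (hd : ∀ k, 2 ≤ {y | d y = k}.ncard)
    (hc12 : {x | c x = 1}.ncard ≤ {x | c x = 2}.ncard)
    (hd01 : {y | d y = 0}.ncard ≤ {y | d y = 1}.ncard)
    (hd12 : {y | d y = 1}.ncard ≤ {y | d y = 2}.ncard)
    (τ : X ≃ Y) (hτ : ∀ S, IsColorFace c S ↔ IsColorFace d (τ '' S)) :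
    {x | c x = 1}.ncard ≤ {y | d y = 1}.ncard := by
  have himg : τ '' (τ.symm '' {y | d y = 1}) = {y | d y = 1} := by
    rw [← Set.image_comp]
    simp
  have h := le_ncard_of_not_isColorFace hc12 (S := τ.symm '' {y | d y = 1}) (by
    rw [hτ, himg]
    exact not_isColorFace_fiber_one hd hd01 hd12)
  rwa [Set.ncard_image_of_injective _ τ.symm.injective] at h

theorem nonempty_orderIso_colorFace_iff [Finite X] [Finite Y]
    (hc : ∀ k, 2 ≤ {x | c x = k}.ncard)
    (hd : ∀ k, 2 ≤ {y | d y = k}.ncard)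
    (hc01 : {x | c x = 0}.ncard ≤ {x | c x = 1}.ncard)
    (hc12 : {x | c x = 1}.ncard ≤ {x | c x = 2}.ncard)
    (hd01 : {y | d y = 0}.ncard ≤ {y | d y = 1}.ncard)
    (hd12 : {y | d y = 1}.ncard ≤ {y | d y = 2}.ncard) :
    Nonempty ({S // IsColorFace c S} ≃o {S // IsColorFace d S}) ↔
      Nat.card X = Nat.card Y ∧
      SameColorType (fun k => {x | c x = k}.ncard) (fun k => {y | d y = k}.ncard) ∧
      {x | c x = 1}.ncard = {y | d y = 1}.ncard := by
  have hcs := sum_ncard_fiber c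
  have hds := sum_ncard_fiber d
  have hc0 := hc 0
  have hd0 := hd 0
  constructor
  · rintro ⟨e⟩
    obtain ⟨τ, hτ⟩ := exists_equiv_of_orderIso
      (isColorFace_of_ncard_lt_two hc (by simp)) (fun x => isColorFace_of_ncard_lt_two hc (by simp))
      (isColorFace_of_ncard_lt_two hd (by simp)) (fun x => isColorFace_of_ncard_lt_two hd (by simp))
      e
    have hτ' : ∀ S, IsColorFace d S ↔ IsColorFace c (τ.symm '' S) := fun S => by
      rw [hτ, ← Set.image_comp]
      simp
    have hcard : Nat.card X = Nat.card Y := Nat.card_congr τ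
    have h1 : {x | c x = 1}.ncard = {y | d y = 1}.ncard :=
      le_antisymm (ncard_one_le_of_equiv hd hc12 hd01 hd12 τ hτ)
        (ncard_one_le_of_equiv hc hd12 hc01 hc12 τ.symm hτ')
    have hiff : ({x | c x = 0}.ncard < {x | c x = 1}.ncard ∧
        {x | c x = 1}.ncard < {x | c x = 2}.ncard) ↔
        ({y | d y = 0}.ncard < {y | d y = 1}.ncard ∧
        {y | d y = 1}.ncard < {y | d y = 2}.ncard) := by
      rw [← unique_minimal_nonface_iff hc hc01 hc12, ← unique_minimal_nonface_iff hd hd01 hd12]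
      constructor
      · intro h S T hS hT hS1 hT1
        rw [hτ'] at hS hT
        apply τ.symm.injective.image_injective
        apply h _ _ hS hT
        · rw [Set.ncard_image_of_injective _ τ.symm.injective, hS1, h1]
        · rw [Set.ncard_image_of_injective _ τ.symm.injective, hT1, h1]
      · intro h S T hS hT hS1 hT1
        rw [hτ] at hS hT
        apply τ.injective.image_injective
        apply h _ _ hS hT
        · rw [Set.ncard_image_of_injective _ τ.injective, hS1, h1]
        · rw [Set.ncard_image_of_injective _ τ.injective, hT1, h1]
    refine ⟨hcard, ?_, h1⟩
    rcases hc01.lt_or_eq with h | h <;> rcases hc12.lt_or_eq with h' | h'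
    · exact ⟨.I, ⟨hc0, h, h'⟩, ⟨hd0, hiff.1 ⟨h, h'⟩⟩⟩
    -- Outside type I the sign of n_0 + n_2 - 2 n_1 (negative, positive, zero) tells II, III and IV
    -- apart, and the total and n_1 determine it.
    all_goals have hn := mt hiff.2 (by omega)
    · exact ⟨.II, ⟨hc0, h, h'⟩, hd0, by beta_reduce; omega, by beta_reduce; omega⟩
    · exact ⟨.III, ⟨hc0, h, h'⟩, hd0, by beta_reduce; omega, by beta_reduce; omega⟩
    · exact ⟨.IV, ⟨hc0, h, h'⟩, hd0, by beta_reduce; omega, by beta_reduce; omega⟩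
  · rintro ⟨hcard, ⟨t, ht, ht'⟩, h1⟩
    by_cases hlt : {x | c x = 0}.ncard < {x | c x = 1}.ncard ∧
        {x | c x = 1}.ncard < {x | c x = 2}.ncard
    · have hlt' : {y | d y = 0}.ncard < {y | d y = 1}.ncard ∧
          {y | d y = 1}.ncard < {y | d y = 2}.ncard := by
        cases t <;> simp only [HasColorType] at ht ht' <;> omega
      -- The bijection need only respect class 1 and its complement, so n_0 and n_2 may differ
      -- between the two sides.
      obtain ⟨τ, hτ⟩ := exists_equiv_of_ncard_fiber_eq (c := fun x => c x = 1)
        (d := fun y => d y = 1) (by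
          intro k
          by_cases hk : k
          · simpa [hk] using h1
          · have hX := Set.ncard_add_ncard_compl {x | c x = 1}
            have hY := Set.ncard_add_ncard_compl {y | d y = 1}
            simp only [hk, eq_iff_iff, iff_false]
            change {x | c x = 1}ᶜ.ncard = {y | d y = 1}ᶜ.ncard
            omega)
      refine nonempty_orderIso_of_equiv τ fun S => ?_
      rw [isColorFace_iff_of_lt hlt.1 hlt.2, isColorFace_iff_of_lt hlt'.1 hlt'.2]
      refine iff_congr ?_ ?_ <;>
      · rw [← τ.forall_congr_right]
        simp [eq_iff_iff.1 (hτ _)]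
    -- A tie with the middle class leaves at most one further size, which the total fixes.
    · have hall : ∀ k, {x | c x = k}.ncard = {y | d y = k}.ncard := by
        refine Fin.forall_fin_succ.2 ⟨?_, Fin.forall_fin_two.2 ⟨h1, ?_⟩⟩
        · cases t <;> simp only [HasColorType] at ht ht' <;> omega
        · change {x | c x = 2}.ncard = {y | d y = 2}.ncard
          cases t <;> simp only [HasColorType] at ht ht' <;> omega
      obtain ⟨τ, hτ⟩ := exists_equiv_of_ncard_fiber_eq hall
      exact nonempty_orderIso_of_equiv τ fun S => (isColorFace_image_iff_of_comp_eq τ hτ S).symm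

end Classification

/-! ### Sorting the colours and the final theorem. -/

/-- The colouring with the colours permuted so that the class sizes increase. -/
noncomputable def sortedColoring {P : Set Space3} (c : polytopeFacets P → Fin 3) :
    polytopeFacets P → Fin 3 :=
  (Tuple.sort (colorCount c)).symm ∘ c

theorem ncard_sortedColoring {P : Set Space3} (c : polytopeFacets P → Fin 3) (k : Fin 3) :
    {f | sortedColoring c f = k}.ncard = colorVector c k := by
  simp [sortedColoring, colorVector, colorCount, Equiv.symm_apply_eq]

theorem monotone_colorVector {P : Set Space3} (c : polytopeFacets P → Fin 3) :
    Monotone (colorVector c) :=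
  Tuple.monotone_sort _

theorem IsSimpleThreePolytope.nonempty_facePoset_orderIso_sorted {P : Set Space3}
    (hP : IsSimpleThreePolytope P) {c : polytopeFacets P → Fin 3} (hc : IsProperColoring P c) :
    Nonempty (FacePoset (incidenceHull P) ≃o {S // IsColorFace (sortedColoring c) S}) := by
  have : IsColorFace (sortedColoring c) = IsColorFace c :=
    funext fun S => propext (isColorFace_perm_comp _ c S)
  rw [this]
  exact hP.nonempty_facePoset_orderIso hc

theorem combinatoriallyEquivalent_incidenceHull_iff {P P' : Set Space3}
    (hP : IsSimpleThreePolytope P) (hP' : IsSimpleThreePolytope P')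
    {c : polytopeFacets P → Fin 3} (hc : IsProperColoring P c)
    {c' : polytopeFacets P' → Fin 3} (hc' : IsProperColoring P' c') :
    CombinatoriallyEquivalent (incidenceHull P) (incidenceHull P') ↔
      (polytopeFacets P).ncard = (polytopeFacets P').ncard ∧
      SameColorType (colorVector c) (colorVector c') ∧
      colorVector c 1 = colorVector c' 1 := by
  have : Finite (polytopeFacets P) := (hP.polytope.finite_faces 2).to_subtype
  have : Finite (polytopeFacets P') := (hP'.polytope.finite_faces 2).to_subtype
  obtain ⟨e⟩ := hP.nonempty_facePoset_orderIso_sorted hc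
  obtain ⟨e'⟩ := hP'.nonempty_facePoset_orderIso_sorted hc'
  have h1 : CombinatoriallyEquivalent (incidenceHull P) (incidenceHull P') ↔
      Nonempty ({S // IsColorFace (sortedColoring c) S} ≃o
        {S // IsColorFace (sortedColoring c') S}) :=
    ⟨fun ⟨ε⟩ => ⟨(e.symm.trans ε).trans e'⟩, fun ⟨ε⟩ => ⟨(e.trans ε).trans e'.symm⟩⟩
  have h2 := nonempty_orderIso_colorFace_iff (c := sortedColoring c) (d := sortedColoring c')
  simp only [ncard_sortedColoring] at h2
  rw [h1]
  exact h2 (fun k => hP.two_le_colorCount hc _) (fun k => hP'.two_le_colorCount hc' _)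
    (monotone_colorVector c (by decide)) (monotone_colorVector c (by decide))
    (monotone_colorVector c' (by decide)) (monotone_colorVector c' (by decide))

theorem theorem5 (P P' : Set Space3)
    (hP : IsSimpleThreePolytope P) (hP' : IsSimpleThreePolytope P')
    (c : polytopeFacets P → Fin 3) (hc : IsProperColoring P c)
    (c' : polytopeFacets P' → Fin 3) (hc' : IsProperColoring P' c') :
    (CombinatoriallyEquivalent (incidenceHull P) (incidenceHull P') ↔
      (polytopeFacets P).ncard = (polytopeFacets P').ncard ∧
      SameColorType (colorVector c) (colorVector c') ∧
      colorVector c 1 = colorVector c' 1) ∧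
    ((polytopeFacets P).ncard = (polytopeFacets P').ncard ↔
      (polytopeVertices P).ncard = (polytopeVertices P').ncard) ∧
    ((polytopeFacets P).ncard = (polytopeFacets P').ncard ↔
      (polytopeEdges P).ncard = (polytopeEdges P').ncard) := by
  have h1 := hP.two_mul_facets
  have h2 := hP'.two_mul_facets
  have h3 := hP.vertices_mul_three
  have h4 := hP'.vertices_mul_three
  exact ⟨combinatoriallyEquivalent_incidenceHull_iff hP hP' hc hc', by omega, by omega⟩
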